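/- Let $W\in C^1(\mathbb R,\mathbb R)$ with $W(0)=0$, and suppose that for some constant $C$ one has $|W'(s)|\le C(|s|+|s|^5)$ for all $s\in\mathbb R$. Let $q>0$. Let $H^1(\mathbb R^3)$ be the usual Sobolev space of real-valued functions, and let $D^{1,2}(\mathbb R^3)$ be the completion of $C_c^\infty(\mathbb R^3)$ in the norm $\|\nabla\varphi\|_{L^2}$. Then for every $u\in H^1(\mathbb R^3)$ the equation $$-\Delta\Phi+q^2u^2\Phi=qu^2$$ has exactly one weak solution $\Phi_u\in D^{1,2}(\mathbb R^3)$, and the functionals $$J(u)=\int_{\mathbb R^3}\Big(\tfrac12|\nabla u|^2+W(u)\Big)\,dx,\qquad K_q(u)=\tfrac12\int_{\mathbb R^3}(1-q\Phi_u)\,u^2\,dx$$ are Fréchet differentiable on $H^1(\mathbb R^3)$. Moreover, if $(u,\omega)\in H^1(\mathbb R^3)\times\mathbb R$ is a solution of the eigenvalue problem $$J'(u)=\omega^2K_q'(u),$$ then, with $\varphi_u=\omega\Phi_u$, the triple $(u,\varphi_u,\omega)$ solves the electrostatic nonlinear Klein-Gordon-Maxwell system $$-\Delta u+W'(u)=(\omega-q\varphi_u)^2u,\qquad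 -\Delta\varphi_u=q(\omega-q\varphi_u)u^2$$ in the weak sense, the first equation tested against all functions of $H^1(\mathbb R^3)$ and the second against all functions of $D^{1,2}(\mathbb R^3)$. -/

import Mathlib

open MeasureTheory Set
open scoped ENNReal InnerProductSpace

noncomputable section

/-- Physical space `ℝ³`, with its Euclidean norm and Lebesgue measure. -/
abbrev R3 : Type := EuclideanSpace ℝ (Fin 3)

instance fact_one_le_six : Fact ((1 : ℝ≥0∞) ≤ 6) := ⟨by norm_num⟩

/-- Smooth compactly supported real functions on `ℝ³`. -/
def IsTest (η : R3 → ℝ) : Prop := ContDiff ℝ (⊤ : ℕ∞) η ∧ HasCompactSupport η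

/-- `g` is the weak (distributional) gradient of `u`, for `u` and `g` of class `L²`:
`∫ u ∂_w η = - ∫ η ⟨g, w⟩` for every direction `w` and every test function `η`. -/
def IsWeakGradient (u : Lp ℝ 2 (volume : Measure R3)) (g : Lp R3 2 (volume : Measure R3)) : Prop :=
  ∀ η : R3 → ℝ, IsTest η → ∀ w : R3,
    ∫ x, u x * fderiv ℝ η x w = - ∫ x, η x * ⟪g x, w⟫_ℝ

theorem IsTest.memLp {η : R3 → ℝ} (h : IsTest η) (p : ℝ≥0∞) :
    MemLp η p (volume : Measure R3) :=
  h.1.continuous.memLp_of_hasCompactSupport h.2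

theorem IsTest.memLp_fderiv {η : R3 → ℝ} (h : IsTest η) (w : R3) (p : ℝ≥0∞) :
    MemLp (fun x => fderiv ℝ η x w) p (volume : Measure R3) := by
  have hc : Continuous (fun x => fderiv ℝ η x w) :=
    (h.1.continuous_fderiv (by simp)).clm_apply continuous_const
  exact hc.memLp_of_hasCompactSupport (h.2.fderiv_apply ℝ w)

theorem IsTest.integrable_left {η : R3 → ℝ} (h : IsTest η)
    (u : Lp ℝ 2 (volume : Measure R3)) (w : R3) :
    Integrable (fun x => u x * fderiv ℝ η x w) :=
  (Lp.memLp u).integrable_mul (h.memLp_fderiv w 2)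

theorem IsTest.integrable_right {η : R3 → ℝ} (h : IsTest η)
    (g : Lp R3 2 (volume : Measure R3)) (w : R3) :
    Integrable (fun x => η x * ⟪g x, w⟫_ℝ) :=
  (h.memLp 2).integrable_mul ((Lp.memLp g).inner_const w)

/-- The Sobolev space `H¹(ℝ³)`, realized as the space of all pairs `(u, ∇u)` with `u ∈ L²`
and weak gradient `∇u ∈ L²`. The norm inherited from the Hilbert sum `L² ⊕ L²` is the usual one,
`‖u‖² = ∫ (u² + |∇u|²)`. -/
def H1Submodule : Submodule ℝ
    (WithLp 2 (Lp ℝ 2 (volume : Measure R3) × Lp R3 2 (volume : Measure R3))) where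
  carrier := {p | IsWeakGradient p.fst p.snd}
  zero_mem' := by
    intro η _ w
    have h1 : ∀ᵐ x, (0 : Lp ℝ 2 (volume : Measure R3)) x = 0 := Lp.coeFn_zero _ _ _
    have h2 : ∀ᵐ x, (0 : Lp R3 2 (volume : Measure R3)) x = 0 := Lp.coeFn_zero _ _ _
    rw [integral_eq_zero_of_ae, integral_eq_zero_of_ae, neg_zero]
    · filter_upwards [h2] with x hx
      simp
    · filter_upwards [h1] with x hx
      simp
  add_mem' := by
    intro a b ha hb η hη w
    have h1 := Lp.coeFn_add a.fst b.fst
    have h2 := Lp.coeFn_add a.snd b.snd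
    have e1 : ∫ x, (a + b).fst x * fderiv ℝ η x w
        = ∫ x, (a.fst x * fderiv ℝ η x w + b.fst x * fderiv ℝ η x w) := by
      refine integral_congr_ae ?_
      filter_upwards [h1] with x hx
      rw [WithLp.add_fst, hx, Pi.add_apply, add_mul]
    have e2 : ∫ x, η x * ⟪(a + b).snd x, w⟫_ℝ
        = ∫ x, (η x * ⟪a.snd x, w⟫_ℝ + η x * ⟪b.snd x, w⟫_ℝ) := by
      refine integral_congr_ae ?_
      filter_upwards [h2] with x hx
      rw [WithLp.add_snd, hx, Pi.add_apply, inner_add_left, mul_add]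
    rw [e1, e2, integral_add (hη.integrable_left _ w) (hη.integrable_left _ w),
      integral_add (hη.integrable_right _ w) (hη.integrable_right _ w),
      ha η hη w, hb η hη w]
    ring
  smul_mem' := by
    intro c a ha η hη w
    have h1 := Lp.coeFn_smul c a.fst
    have h2 := Lp.coeFn_smul c a.snd
    have e1 : ∫ x, (c • a).fst x * fderiv ℝ η x w
        = ∫ x, c * (a.fst x * fderiv ℝ η x w) := by
      refine integral_congr_ae ?_
      filter_upwards [h1] with x hx
      rw [WithLp.smul_fst, hx, Pi.smul_apply, smul_eq_mul, mul_assoc]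
    have e2 : ∫ x, η x * ⟪(c • a).snd x, w⟫_ℝ
        = ∫ x, c * (η x * ⟪a.snd x, w⟫_ℝ) := by
      refine integral_congr_ae ?_
      filter_upwards [h2] with x hx
      rw [WithLp.smul_snd, hx, Pi.smul_apply, real_inner_smul_left]
      ring
    rw [e1, e2, integral_const_mul, integral_const_mul, ha η hη w]
    ring

/-- The space `H¹(ℝ³)` as a type. -/
abbrev H1 : Type := H1Submodule

/-- The function underlying an element of `H¹(ℝ³)`. -/
def H1.fn (u : H1) : R3 → ℝ := u.1.fst

/-- The weak gradient of an element of `H¹(ℝ³)`. -/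
def H1.grad (u : H1) : R3 → R3 := u.1.snd

/-- All pairs `(η, ∇η)`, with `η` a test function, as elements of `L⁶ × L²`. -/
def testGraph : Submodule ℝ (Lp ℝ 6 (volume : Measure R3) × Lp R3 2 (volume : Measure R3)) where
  carrier := {p | ∃ η : R3 → ℝ, IsTest η ∧ p.1 =ᵐ[volume] η ∧ p.2 =ᵐ[volume] gradient η}
  zero_mem' := by
    refine ⟨fun _ => 0, ⟨contDiff_const, HasCompactSupport.zero⟩, Lp.coeFn_zero _ _ _, ?_⟩
    filter_upwards [Lp.coeFn_zero R3 2 (volume : Measure R3)] with x hx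
    rw [Prod.snd_zero, hx]
    simp [gradient]
  add_mem' := by
    rintro a b ⟨η, hη, h1, h2⟩ ⟨θ, hθ, h3, h4⟩
    refine ⟨η + θ, ⟨hη.1.add hθ.1, hη.2.add hθ.2⟩, ?_, ?_⟩
    · filter_upwards [Lp.coeFn_add a.1 b.1, h1, h3] with x hx hx1 hx3
      rw [Prod.fst_add, hx, Pi.add_apply, Pi.add_apply, hx1, hx3]
    · filter_upwards [Lp.coeFn_add a.2 b.2, h2, h4] with x hx hx2 hx4
      have d1 : DifferentiableAt ℝ η x := hη.1.differentiable (by simp) x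
      have d2 : DifferentiableAt ℝ θ x := hθ.1.differentiable (by simp) x
      rw [Prod.snd_add, hx, Pi.add_apply, hx2, hx4]
      simp only [gradient]
      rw [fderiv_add d1 d2, map_add]
  smul_mem' := by
    rintro c a ⟨η, hη, h1, h2⟩
    refine ⟨c • η, ⟨contDiff_const.smul hη.1, hη.2.smul_left⟩, ?_, ?_⟩
    · filter_upwards [Lp.coeFn_smul c a.1, h1] with x hx hx1
      rw [Prod.smul_fst, hx, Pi.smul_apply, Pi.smul_apply, hx1]
    · filter_upwards [Lp.coeFn_smul c a.2, h2] with x hx hx2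
      have d1 : DifferentiableAt ℝ η x := hη.1.differentiable (by simp) x
      rw [Prod.smul_snd, hx, Pi.smul_apply, hx2]
      simp only [gradient]
      rw [fderiv_const_smul d1, map_smulₛₗ]
      simp

/-- The space `D^{1,2}(ℝ³)`, the completion of the test functions for the norm `‖∇φ‖_{L²}`,
realized (by the Sobolev inequality `‖η‖_{L⁶} ≤ S ‖∇η‖_{L²}`) as the space of the pairs
`(φ, ∇φ) ∈ L⁶ × L²` that are limits in `L⁶ × L²` of pairs `(η, ∇η)` with `η` a test function. -/
def D12Submodule : Submodule ℝ (Lp ℝ 6 (volume : Measure R3) × Lp R3 2 (volume : Measure R3)) :=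
  testGraph.topologicalClosure

/-- The space `D^{1,2}(ℝ³)` as a type. -/
abbrev D12 : Type := D12Submodule

/-- The function underlying an element of `D^{1,2}(ℝ³)`. -/
def D12.fn (φ : D12) : R3 → ℝ := φ.1.1

/-- The weak gradient of an element of `D^{1,2}(ℝ³)`. -/
def D12.grad (φ : D12) : R3 → R3 := φ.1.2

/-- `Φ ∈ D^{1,2}` is a weak solution of `-ΔΦ + q² u² Φ = q u²`. -/
def SolvesPhi (q : ℝ) (u : H1) (Φ : D12) : Prop :=
  ∀ ψ : D12,
    Integrable (fun x => u.fn x ^ 2 * Φ.fn x * ψ.fn x) ∧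
    Integrable (fun x => u.fn x ^ 2 * ψ.fn x) ∧
    (∫ x, ⟪Φ.grad x, ψ.grad x⟫_ℝ) + q ^ 2 * ∫ x, u.fn x ^ 2 * Φ.fn x * ψ.fn x
      = q * ∫ x, u.fn x ^ 2 * ψ.fn x

open Classical in
/-- `Φ_u`, the solution in `D^{1,2}` of `-ΔΦ + q² u² Φ = q u²`. -/
def Phi (q : ℝ) (u : H1) : D12 :=
  if h : ∃ Φ : D12, SolvesPhi q u Φ then h.choose else 0

/-- `J(u) = ∫ (½ |∇u|² + W(u))`. -/
def J (W : ℝ → ℝ) (u : H1) : ℝ :=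
  ∫ x, ((1 / 2) * ‖u.grad x‖ ^ 2 + W (u.fn x))

/-- `K_q(u) = ½ ∫ (1 - q Φ_u) u²`. -/
def K (q : ℝ) (u : H1) : ℝ :=
  (1 / 2) * ∫ x, (1 - q * (Phi q u).fn x) * u.fn x ^ 2

/-- `(u, φ, ω)` is a weak solution of `-Δu + W'(u) = (ω - q φ)² u`. -/
def SolvesMatter (W : ℝ → ℝ) (q : ℝ) (u : H1) (φ : D12) (ω : ℝ) : Prop :=
  ∀ v : H1,
    Integrable (fun x => deriv W (u.fn x) * v.fn x) ∧
    Integrable (fun x => (ω - q * φ.fn x) ^ 2 * u.fn x * v.fn x) ∧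
    (∫ x, ⟪u.grad x, v.grad x⟫_ℝ) + ∫ x, deriv W (u.fn x) * v.fn x
      = ∫ x, (ω - q * φ.fn x) ^ 2 * u.fn x * v.fn x

/-- `(u, φ, ω)` is a weak solution of `-Δφ = q (ω - q φ) u²`. -/
def SolvesGauss (q : ℝ) (u : H1) (φ : D12) (ω : ℝ) : Prop :=
  ∀ ψ : D12,
    Integrable (fun x => (ω - q * φ.fn x) * u.fn x ^ 2 * ψ.fn x) ∧
    ∫ x, ⟪φ.grad x, ψ.grad x⟫_ℝ = q * ∫ x, (ω - q * φ.fn x) * u.fn x ^ 2 * ψ.fn x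

end

open Filter Topology ContinuousLinearMap
open scoped NNReal Convolution

/-! Write `ι : H¹ → L²` for the inclusion, `P u Φ = uΦ` and `G = ∇ : D^{1,2} → L²`. The Sobolev
embeddings make `P` a bounded bilinear map into `L²` and `G` bounded below, so the field equation
becomes an abstract Hilbert space problem (`SolvesField`), solved by Riesz.

The key to `K_q` is a variational reading: `K_q(u)` is the minimum over `Φ` of `½(‖ι u - q P u Φ‖² +
‖G Φ‖²)`, attained at `Φ_u`. Replacing `Φ_v` by the frozen `Φ_u` costs only an error `O(‖v - u‖²)`,
so `K_q'(u)` is the partial derivative in `u` alone (`SolvesField.hasFDerivAt`), and no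
differentiability of `u ↦ Φ_u` is needed. Hence `K_q'(u)v = ∫ (1 - qΦ_u)² u v`, and `J'(u) = ω²
K_q'(u)` is the matter equation with `φ = ωΦ_u`; the Gauss equation is `ω` times the field equation.

For `J`, the gradient term is quadratic. The term `∫ W(u)` needs a Taylor remainder that is `o(‖v‖)`
under critical growth (`exists_lintegral_remainder_le`): very small and very large values of `u`
carry little `L²` and `L⁶` norm, and on the remaining compact range of values `W'` is uniformly
continuous. -/

/-! ### Mollification and the Sobolev inequalities. -/

theorem eLpNorm_two_rpow {α F : Type*} [MeasurableSpace α] [NormedAddCommGroup F]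
    (μ : Measure α) (f : α → F) :
    eLpNorm f 2 μ ^ (2 : ℝ) = ∫⁻ x, ‖f x‖ₑ ^ (2 : ℝ) ∂μ := by
  simpa using eLpNorm_nnreal_pow_eq_lintegral (f := f) (μ := μ) (p := 2) two_ne_zero

/-- Convolution with a normalized bump function does not increase the `L²` norm. -/
theorem eLpNorm_normed_convolution_le {F : Type*} [NormedAddCommGroup F] [NormedSpace ℝ F]
    (φ : ContDiffBump (0 : R3)) {f : R3 → F} (hf : StronglyMeasurable f) :
    eLpNorm ((φ.normed volume) ⋆[lsmul ℝ ℝ, volume] f) 2 volume ≤ eLpNorm f 2 volume := by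
  set k : R3 → ℝ := φ.normed volume
  have hk : Measurable fun t => ‖k t‖ₑ := φ.continuous_normed.measurable.enorm
  have hk1 : ∫⁻ t, ‖k t‖ₑ = 1 := by
    have h := ofReal_integral_norm_eq_lintegral_enorm (φ.integrable_normed (μ := volume))
    rw [← h]
    simp_rw [Real.norm_of_nonneg (φ.nonneg_normed _), φ.integral_normed, ENNReal.ofReal_one]
  -- With the kernel as a probability density, convolution is an average: Jensen bounds its square
  -- pointwise, and translation invariance integrates the bound.
  set ν : Measure R3 := volume.withDensity fun t => ‖k t‖ₑ
  have : IsProbabilityMeasure ν := ⟨by simpa [ν] using hk1⟩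
  have hmeas : StronglyMeasurable (fun p : R3 × R3 => f (p.1 - p.2)) :=
    hf.comp_measurable (measurable_fst.sub measurable_snd)
  have h1 : ∀ x, ‖((φ.normed volume) ⋆[lsmul ℝ ℝ, volume] f) x‖ₑ ^ (2 : ℝ)
      ≤ ∫⁻ t, ‖f (x - t)‖ₑ ^ (2 : ℝ) ∂ν := by
    intro x
    have hx : StronglyMeasurable (fun t => f (x - t)) :=
      hf.comp_measurable (measurable_const.sub measurable_id)
    have h2 : ‖((φ.normed volume) ⋆[lsmul ℝ ℝ, volume] f) x‖ₑ
        ≤ eLpNorm (fun t => f (x - t)) 1 ν := by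
      rw [eLpNorm_one_eq_lintegral_enorm, lintegral_withDensity_eq_lintegral_mul _ hk hx.enorm]
      refine (enorm_integral_le_lintegral_enorm _).trans (lintegral_mono fun t => ?_)
      simp [enorm_smul, k]
    rw [← eLpNorm_two_rpow]
    gcongr
    exact h2.trans
      (eLpNorm_le_eLpNorm_of_exponent_le one_le_two hx.aestronglyMeasurable)
  rw [← ENNReal.rpow_le_rpow_iff (z := 2) two_pos, eLpNorm_two_rpow, eLpNorm_two_rpow]
  calc _ ≤ ∫⁻ x, ∫⁻ t, ‖f (x - t)‖ₑ ^ (2 : ℝ) ∂ν := lintegral_mono h1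
    _ = ∫⁻ t, (∫⁻ x, ‖f (x - t)‖ₑ ^ (2 : ℝ)) ∂ν :=
      lintegral_lintegral_swap (hmeas.enorm.pow_const _).aemeasurable
    _ = ∫⁻ _, (∫⁻ x, ‖f x‖ₑ ^ (2 : ℝ)) ∂ν := by
      refine lintegral_congr fun t => ?_
      exact lintegral_sub_right_eq_self (fun x => ‖f x‖ₑ ^ (2 : ℝ)) t
    _ = _ := by simp

/-- The gradient of a mollification is the mollification of the weak gradient. -/
theorem IsWeakGradient.hasFDerivAt_convolution {u : Lp ℝ 2 (volume : Measure R3)}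
    {g : Lp R3 2 (volume : Measure R3)} (h : IsWeakGradient u g) (φ : ContDiffBump (0 : R3))
    (x : R3) :
    HasFDerivAt ((φ.normed volume) ⋆[lsmul ℝ ℝ, volume] u)
      (innerSL ℝ (((φ.normed volume) ⋆[lsmul ℝ ℝ, volume] g) x)) x := by
  set k : R3 → ℝ := φ.normed volume
  have hk : ContDiff ℝ (⊤ : ℕ∞) k := φ.contDiff_normed
  have hk1 : ContDiff ℝ 1 k := φ.contDiff_normed (n := 1)
  have hkc : HasCompactSupport k := φ.hasCompactSupport_normed
  have hu : LocallyIntegrable (u : R3 → ℝ) := (Lp.memLp u).locallyIntegrable one_le_two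
  have hg : LocallyIntegrable (g : R3 → R3) := (Lp.memLp g).locallyIntegrable one_le_two
  let B : ℝ →L[ℝ] ℝ →L[ℝ] ℝ := lsmul ℝ ℝ
  refine (hkc.hasFDerivAt_convolution_left B hk1 hu x).congr_fderiv ?_
  refine ContinuousLinearMap.ext fun w => Eq.symm ?_
  have hint : Integrable fun t => B.precompL R3 (fderiv ℝ k t) (u (x - t)) :=
    (hkc.fderiv ℝ).convolutionExists_left (B.precompL R3) (hk1.continuous_fderiv one_ne_zero) hu x
  have hint2 : Integrable fun t => (lsmul ℝ ℝ : ℝ →L[ℝ] R3 →L[ℝ] R3) (k t) (g (x - t)) :=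
    hkc.convolutionExists_left (lsmul ℝ ℝ : ℝ →L[ℝ] R3 →L[ℝ] R3) hk1.continuous hg x
  rw [convolution_def, convolution_def, ContinuousLinearMap.integral_apply hint,
    innerSL_apply_apply, real_inner_comm, ← integral_inner hint2]
  -- The weak gradient is tested against the reflected kernel; the sign from the reflection cancels
  -- the one in `IsWeakGradient`.
  have hη : IsTest fun t => k (x - t) :=
    ⟨hk.comp (contDiff_const.sub contDiff_id),
      hkc.comp_homeomorph (Homeomorph.subLeft x)⟩
  have hd : ∀ t, fderiv ℝ (fun t => k (x - t)) t w = - fderiv ℝ k (x - t) w := by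
    intro t
    have h1 : HasFDerivAt (fun t => x - t) (-ContinuousLinearMap.id ℝ R3) t :=
      (hasFDerivAt_id t).const_sub x
    have h2 := ((hk1.differentiable one_ne_zero (x - t)).hasFDerivAt.comp t h1).fderiv
    rw [Function.comp_def] at h2
    simp [h2]
  have key := h _ hη w
  rw [← integral_sub_left_eq_self _ _ x, ← integral_sub_left_eq_self (fun t =>
    (B.precompL R3 (fderiv ℝ k t) (u (x - t))) w) _ x]
  simp only [sub_sub_cancel, ContinuousLinearMap.precompL_apply, lsmul_apply, B, smul_eq_mul,
    real_inner_smul_right]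
  simp only [hd, mul_neg, integral_neg, neg_inj] at key
  simp only [real_inner_comm _ w, mul_comm _ (u _ : ℝ), key]

/-- The Sobolev constant of `ℝ³`. -/
noncomputable def sobolevConst : ℝ≥0 :=
  eLpNormLESNormFDerivOfEqInnerConst (volume : Measure R3) 2

theorem eLpNorm_six_le {u : R3 → ℝ} (hu : ContDiff ℝ 1 u) (hc : HasCompactSupport u) :
    eLpNorm u 6 volume ≤ sobolevConst * eLpNorm (fderiv ℝ u) 2 volume := by
  have := eLpNorm_le_eLpNorm_fderiv_of_eq_inner (F' := ℝ) (volume : Measure R3) hu hc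
    (p := 2) (p' := 6) one_le_two (by simp) (by simp; norm_num)
  exact_mod_cast this

/-- Dilations `f(x / (n + 1))` of one bump; dilating only shrinks the gradient. -/
theorem exists_cutoff : ∃ (χ : ℕ → R3 → ℝ) (c : ℝ), (∀ n, IsTest (χ n)) ∧
    (∀ n x, ‖χ n x‖ ≤ 1) ∧ (∀ n x, ‖fderiv ℝ (χ n) x‖ ≤ c) ∧
    ∀ x, ∀ᶠ n in atTop, χ n x = 1 := by
  let f : ContDiffBump (0 : R3) := ⟨1, 2, one_pos, one_lt_two⟩
  have hf : ContDiff ℝ (⊤ : ℕ∞) f := f.contDiff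
  obtain ⟨c, hc⟩ := (f.hasCompactSupport.fderiv ℝ).exists_bound_of_continuous
    (hf.continuous_fderiv (by simp))
  have hpos : ∀ n : ℕ, (0 : ℝ) < ((n : ℝ) + 1)⁻¹ := fun n => by positivity
  refine ⟨fun n x => f (((n : ℝ) + 1)⁻¹ • x), c, fun n => ⟨?_, ?_⟩, fun n x => ?_, fun n x => ?_,
    fun x => ?_⟩
  · exact hf.comp (contDiff_const_smul _)
  · exact f.hasCompactSupport.comp_smul (hpos n).ne'
  · rw [Real.norm_of_nonneg f.nonneg]
    exact f.le_one
  · have h2 : fderiv ℝ (fun x : R3 => f (((n : ℝ) + 1)⁻¹ • x)) x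
        = ((n : ℝ) + 1)⁻¹ • fderiv ℝ f (((n : ℝ) + 1)⁻¹ • x) := by
      simpa using fderiv_comp_smul (𝕜 := ℝ) (f := f) (x := x) (((n : ℝ) + 1)⁻¹)
    rw [h2]
    rw [norm_smul, Real.norm_of_nonneg (hpos n).le]
    have h1 : ((n : ℝ) + 1)⁻¹ ≤ 1 := inv_le_one_of_one_le₀ (by simp)
    calc _ ≤ 1 * ‖fderiv ℝ f (((n : ℝ) + 1)⁻¹ • x)‖ := by gcongr
      _ ≤ c := by rw [one_mul]; exact hc _
  · obtain ⟨N, hN⟩ := exists_nat_ge ‖x‖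
    filter_upwards [eventually_ge_atTop N] with n hn
    apply f.one_of_mem_closedBall
    rw [mem_closedBall_zero_iff, norm_smul, Real.norm_of_nonneg (hpos n).le]
    rw [inv_mul_le_one₀ (by positivity)]
    have : (N : ℝ) ≤ n := by exact_mod_cast hn
    linarith

/-- The Sobolev inequality in `H¹(ℝ³)`. -/
theorem IsWeakGradient.exists_eLpNorm_six_le : ∃ c : ℝ≥0,
    ∀ (u : Lp ℝ 2 (volume : Measure R3)) (g : Lp R3 2 (volume : Measure R3)),
      IsWeakGradient u g →
      eLpNorm u 6 volume ≤ c * (eLpNorm u 2 volume + eLpNorm g 2 volume) := by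
  obtain ⟨χ, c, hχ, hχ1, hχc, hχe⟩ := exists_cutoff
  refine ⟨sobolevConst * max 1 c.toNNReal, fun u g hug => ?_⟩
  let φ : ℕ → ContDiffBump (0 : R3) := fun n =>
    ⟨((n : ℝ) + 1)⁻¹, 2 * ((n : ℝ) + 1)⁻¹, by positivity,
      by have : (0 : ℝ) < ((n : ℝ) + 1)⁻¹ := by positivity
         linarith⟩
  have hu : LocallyIntegrable (u : R3 → ℝ) := (Lp.memLp u).locallyIntegrable one_le_two
  have hlim := ContDiffBump.ae_convolution_tendsto_right_of_locallyIntegrable (φ := φ)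
    (l := atTop) (K := 2) (μ := volume) (g := u) (by
      have := (tendsto_one_div_add_atTop_nhds_zero_nat (𝕜 := ℝ)).const_mul 2
      simpa [φ] using this) (.of_forall fun n => le_rfl) hu
  let U : ℕ → R3 → ℝ := fun n => ((φ n).normed volume) ⋆[lsmul ℝ ℝ, volume] u
  let V : ℕ → R3 → R3 := fun n => ((φ n).normed volume) ⋆[lsmul ℝ ℝ, volume] g
  have hU : ∀ n, ContDiff ℝ 1 (U n) := fun n =>
    (φ n).hasCompactSupport_normed.contDiff_convolution_left (n := 1) _
      ((φ n).contDiff_normed (n := 1)) hu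
  have hUV : ∀ n x, HasFDerivAt (U n) (innerSL ℝ (V n x)) x := fun n x =>
    hug.hasFDerivAt_convolution (φ n) x
  have hfd : ∀ n x, ‖fderiv ℝ (fun x => χ n x * U n x) x‖
      ≤ ‖V n x‖ + ‖c * U n x‖ := by
    intro n x
    have h1 := ((hχ n).1.differentiable (by simp) x).hasFDerivAt.mul (hUV n x)
    rw [show (fun x => χ n x * U n x) = χ n * U n from rfl, h1.fderiv]
    refine (norm_add_le _ _).trans (add_le_add ?_ ?_)
    · rw [norm_smul, innerSL_apply_norm]
      exact mul_le_of_le_one_left (norm_nonneg _) (hχ1 n x)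
    · rw [norm_smul, norm_mul, mul_comm]
      gcongr
      exact (hχc n x).trans (le_abs_self c)
  have hVm : ∀ n, Continuous (V n) := fun n =>
    (φ n).hasCompactSupport_normed.continuous_convolution_left _ (φ n).continuous_normed
      ((Lp.memLp g).locallyIntegrable one_le_two)
  have hb : ∀ n, eLpNorm (fun x => χ n x * U n x) 6 volume
      ≤ ↑(sobolevConst * max 1 c.toNNReal) * (eLpNorm u 2 volume + eLpNorm g 2 volume) := by
    intro n
    refine (eLpNorm_six_le (((hχ n).1.of_le (by simp)).mul (hU n)) (hχ n).2.mul_right).trans ?_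
    rw [ENNReal.coe_mul, mul_assoc]
    gcongr
    calc eLpNorm (fderiv ℝ fun x => χ n x * U n x) 2 volume
        ≤ eLpNorm (fun x => ‖V n x‖ + ‖c * U n x‖) 2 volume :=
          eLpNorm_mono_real (hfd n)
      _ ≤ eLpNorm (fun x => ‖V n x‖) 2 volume + eLpNorm (fun x => ‖c * U n x‖) 2 volume :=
          eLpNorm_add_le (hVm n).norm.aestronglyMeasurable
            (continuous_const.mul (hU n).continuous).norm.aestronglyMeasurable one_le_two
      _ ≤ eLpNorm g 2 volume + max 1 c.toNNReal * eLpNorm u 2 volume := by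
          rw [eLpNorm_norm, eLpNorm_norm]
          refine add_le_add (eLpNorm_normed_convolution_le _ (Lp.stronglyMeasurable g)) ?_
          have h0 : 0 ≤ c := (norm_nonneg _).trans (hχc 0 0)
          have h2 : eLpNorm (fun x => c * U n x) 2 volume = ‖c‖ₑ * eLpNorm (U n) 2 volume :=
            eLpNorm_const_smul c (U n) 2 volume
          rw [h2]
          gcongr
          · rw [Real.enorm_of_nonneg h0]
            exact ENNReal.coe_le_coe.2 (le_max_right _ _)
          · exact eLpNorm_normed_convolution_le _ (Lp.stronglyMeasurable u)
      _ ≤ _ := by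
          rw [mul_add, add_comm]
          gcongr
          exact le_mul_of_one_le_left' (by exact_mod_cast le_max_left _ _)
  -- Fatou: the truncated mollifications converge to `u` almost everywhere and satisfy the bound
  -- uniformly in `n`.
  refine (Lp.eLpNorm_lim_le_liminf_eLpNorm (f := fun n x => χ n x * U n x)
    (fun n => ((hχ n).1.continuous.mul (hU n).continuous).aestronglyMeasurable) u ?_).trans
    (liminf_le_of_le (by isBoundedDefault) fun b hb' => ?_)
  · filter_upwards [hlim] with x hx
    refine hx.congr' ?_
    filter_upwards [hχe x] with n hn
    rw [hn, one_mul]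
  · obtain ⟨n, hn⟩ := hb'.exists
    exact hn.trans (hb n)

/-- The Sobolev inequality in `D^{1,2}(ℝ³)`. -/
theorem norm_fst_le_of_mem_D12Submodule {p : Lp ℝ 6 (volume : Measure R3) × Lp R3 2 volume}
    (hp : p ∈ D12Submodule) : ‖p.1‖ ≤ sobolevConst * ‖p.2‖ := by
  have hcl : IsClosed {p : Lp ℝ 6 (volume : Measure R3) × Lp R3 2 (volume : Measure R3) |
      ‖p.1‖ ≤ sobolevConst * ‖p.2‖} :=
    isClosed_le continuous_fst.norm (continuous_const.mul continuous_snd.norm)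
  refine closure_minimal (fun p hp => ?_) hcl hp
  obtain ⟨η, hη, h1, h2⟩ := hp
  have h := eLpNorm_six_le (hη.1.of_le (by simp)) hη.2
  have h3 : eLpNorm (fderiv ℝ η) 2 volume = eLpNorm p.2 2 volume := by
    rw [eLpNorm_congr_ae h2]
    refine eLpNorm_congr_norm_ae (.of_forall fun x => ?_)
    simp [gradient]
  rw [h3, ← eLpNorm_congr_ae h1] at h
  have := ENNReal.toReal_mono (ENNReal.mul_ne_top ENNReal.coe_ne_top (Lp.memLp p.2).2.ne) h
  rwa [ENNReal.toReal_mul, ENNReal.coe_toReal] at this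

/-! ### Hölder exponents and the embeddings of `H¹` and `D^{1,2}`. -/

theorem ENNReal.holderTriple_four_twelve_three : ENNReal.HolderTriple 4 12 3 := by
  refine ⟨?_⟩
  rw [← ENNReal.toReal_eq_toReal_iff' (by simp) (by simp), ENNReal.toReal_add (by simp) (by simp)]
  simp only [ENNReal.toReal_inv, ENNReal.toReal_ofNat]
  norm_num

instance ENNReal.holderTriple_three_six_two : ENNReal.HolderTriple 3 6 2 := by
  refine ⟨?_⟩
  rw [← ENNReal.toReal_eq_toReal_iff' (by simp) (by simp), ENNReal.toReal_add (by simp) (by simp)]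
  simp only [ENNReal.toReal_inv, ENNReal.toReal_ofNat]
  norm_num

/-- Interpolation of `L³` between `L²` and `L⁶`. -/
theorem eLpNorm_three_le {α : Type*} [MeasurableSpace α] {μ : Measure α} {f : α → ℝ}
    (hf : AEStronglyMeasurable f μ) :
    eLpNorm f 3 μ ≤ eLpNorm f 2 μ ^ (1 / 2 : ℝ) * eLpNorm f 6 μ ^ (1 / 2 : ℝ) := by
  have := ENNReal.holderTriple_four_twelve_three
  have hm : AEStronglyMeasurable (fun x => ‖f x‖ ^ (1 / 2 : ℝ)) μ :=
    (hf.norm.aemeasurable.pow_const _).aestronglyMeasurable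
  -- Hölder for `|f| = |f|^{1/2} |f|^{1/2}`, the factors being in `L⁴` and `L¹²`.
  have h := eLpNorm_smul_le_mul_eLpNorm (p := 4) (q := 12) (r := 3) hm hm
  have e1 : (4 : ℝ≥0∞) * ENNReal.ofReal (1 / 2) = 2 := by
    rw [← ENNReal.ofReal_ofNat, ← ENNReal.ofReal_mul (by norm_num)]; norm_num
  have e2 : (12 : ℝ≥0∞) * ENNReal.ofReal (1 / 2) = 6 := by
    rw [← ENNReal.ofReal_ofNat, ← ENNReal.ofReal_mul (by norm_num)]; norm_num
  rw [eLpNorm_norm_rpow _ (by norm_num), eLpNorm_norm_rpow _ (by norm_num), e1, e2] at h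
  refine le_trans (eLpNorm_mono fun x => ?_) h
  rw [Pi.smul_apply', smul_eq_mul, ← Real.rpow_add' (norm_nonneg _) (by norm_num)]
  norm_num

namespace H1

/-- The inclusion `H¹ → L²`. -/
noncomputable def toL2 : H1 →L[ℝ] Lp ℝ 2 (volume : Measure R3) :=
  (WithLp.fstL 2 ℝ _ _).comp H1Submodule.subtypeL

/-- The weak gradient as an operator `H¹ → L²`. -/
noncomputable def gradL : H1 →L[ℝ] Lp R3 2 (volume : Measure R3) :=
  (WithLp.sndL 2 ℝ _ _).comp H1Submodule.subtypeL

theorem coe_toL2 (u : H1) : ⇑(toL2 u) = u.fn := rfl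

theorem norm_toL2_le (u : H1) : ‖toL2 u‖ ≤ ‖u‖ := WithLp.norm_fst_le _ u.1

theorem norm_gradL_le (u : H1) : ‖gradL u‖ ≤ ‖u‖ := WithLp.norm_snd_le _ u.1

theorem memLp_two (u : H1) : MemLp u.fn 2 := Lp.memLp (toL2 u)

theorem eLpNorm_two_le (u : H1) : eLpNorm u.fn 2 volume ≤ ‖u‖ₑ := by
  rw [← coe_toL2, ← Lp.enorm_def]
  exact enorm_le_iff_norm_le.2 (norm_toL2_le u)

theorem exists_eLpNorm_six_le : ∃ c : ℝ≥0, ∀ u : H1, eLpNorm u.fn 6 volume ≤ c * ‖u‖ₑ := by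
  obtain ⟨c, hc⟩ := IsWeakGradient.exists_eLpNorm_six_le
  refine ⟨c * 2, fun u => (hc _ _ u.2).trans ?_⟩
  rw [ENNReal.coe_mul, mul_assoc]
  gcongr
  rw [ENNReal.coe_ofNat, two_mul]
  refine add_le_add (eLpNorm_two_le u) ?_
  change eLpNorm (gradL u) 2 volume ≤ _
  rw [← Lp.enorm_def]
  exact enorm_le_iff_norm_le.2 (norm_gradL_le u)

/-- The norm of the embedding `H¹ → L⁶`, if larger than `1`. -/
noncomputable def embConst : ℝ≥0 := max 1 exists_eLpNorm_six_le.choose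

theorem eLpNorm_six_le (u : H1) : eLpNorm u.fn 6 volume ≤ embConst * ‖u‖ₑ :=
  (exists_eLpNorm_six_le.choose_spec u).trans (by gcongr; exact le_max_right _ _)

theorem eLpNorm_two_le' (u : H1) : eLpNorm u.fn 2 volume ≤ embConst * ‖u‖ₑ :=
  (eLpNorm_two_le u).trans
    (le_mul_of_one_le_left' (by exact_mod_cast le_max_left 1 exists_eLpNorm_six_le.choose))

theorem memLp_six (u : H1) : MemLp u.fn 6 :=
  ⟨u.memLp_two.1, (eLpNorm_six_le u).trans_lt (by finiteness)⟩

theorem eLpNorm_three_le (u : H1) : eLpNorm u.fn 3 volume ≤ embConst * ‖u‖ₑ := by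
  refine (_root_.eLpNorm_three_le u.memLp_two.1).trans ?_
  calc _ ≤ (embConst * ‖u‖ₑ) ^ (1 / 2 : ℝ) * (embConst * ‖u‖ₑ) ^ (1 / 2 : ℝ) := by
        gcongr
        exacts [eLpNorm_two_le' u, eLpNorm_six_le u]
    _ = _ := by
        rw [← ENNReal.rpow_add_of_nonneg _ _ (by norm_num) (by norm_num)]
        norm_num

theorem memLp_three (u : H1) : MemLp u.fn 3 :=
  ⟨u.memLp_two.1, (eLpNorm_three_le u).trans_lt (by finiteness)⟩

theorem fn_add (u v : H1) : (u + v).fn =ᵐ[volume] u.fn + v.fn :=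
  Lp.coeFn_add (toL2 u) (toL2 v)

theorem fn_smul (c : ℝ) (u : H1) : (c • u).fn =ᵐ[volume] c • u.fn :=
  Lp.coeFn_smul c (toL2 u)

instance fact_one_le_three : Fact ((1 : ℝ≥0∞) ≤ 3) := ⟨by norm_num⟩

/-- The embedding `H¹ → L³`. -/
noncomputable def toL3 : H1 →L[ℝ] Lp ℝ 3 (volume : Measure R3) :=
  LinearMap.mkContinuous
    { toFun := fun u => u.memLp_three.toLp
      map_add' := fun u v => by
        rw [← MemLp.toLp_add]
        exact MemLp.toLp_congr _ _ (fn_add u v)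
      map_smul' := fun c u => by
        rw [RingHom.id_apply, ← MemLp.toLp_const_smul]
        exact MemLp.toLp_congr _ _ (fn_smul c u) } embConst fun u => by
    change ‖u.memLp_three.toLp‖ ≤ _
    rw [Lp.norm_toLp]
    have := ENNReal.toReal_mono (by finiteness) (eLpNorm_three_le u)
    simpa using this

theorem coeFn_toL3 (u : H1) : toL3 u =ᵐ[volume] u.fn := u.memLp_three.coeFn_toLp

end H1

namespace D12

instance : CompleteSpace D12 :=
  (Submodule.isClosed_topologicalClosure testGraph).completeSpace_coe

/-- The embedding `D^{1,2} → L⁶`. -/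
noncomputable def toL6 : D12 →L[ℝ] Lp ℝ 6 (volume : Measure R3) :=
  (ContinuousLinearMap.fst ℝ _ _).comp D12Submodule.subtypeL

/-- The gradient as an operator `D^{1,2} → L²`. -/
noncomputable def gradL : D12 →L[ℝ] Lp R3 2 (volume : Measure R3) :=
  (ContinuousLinearMap.snd ℝ _ _).comp D12Submodule.subtypeL

/-- By Sobolev the gradient alone controls the norm of `D12`, the maximum of the `L⁶` and `L²`
norms. This is the coercivity behind existence and uniqueness of `Φ_u`. -/
theorem antilipschitz_gradL : AntilipschitzWith (max 1 sobolevConst) gradL := by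
  refine gradL.antilipschitz_of_bound fun φ => ?_
  have h1 : ‖toL6 φ‖ ≤ sobolevConst * ‖gradL φ‖ := norm_fst_le_of_mem_D12Submodule φ.2
  have h2 : ‖φ‖ = max ‖toL6 φ‖ ‖gradL φ‖ := rfl
  rw [h2]
  refine max_le (h1.trans ?_) (le_mul_of_one_le_left (norm_nonneg _) ?_)
  · gcongr
    exact le_max_right _ _
  · exact_mod_cast le_max_left _ _

end D12

/-! ### Products `uΦ` in `L²`, from `1/3 + 1/6 = 1/2`. -/

/-- Multiplication `H¹ × D^{1,2} → L²`. -/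
noncomputable def mulL : H1 →L[ℝ] D12 →L[ℝ] Lp ℝ 2 (volume : Measure R3) :=
  ((ContinuousLinearMap.mul ℝ ℝ).holderL volume 3 6 2).bilinearComp H1.toL3 D12.toL6

theorem coeFn_mulL (u : H1) (φ : D12) :
    mulL u φ =ᵐ[volume] fun x => u.fn x * φ.fn x := by
  have h := (ContinuousLinearMap.mul ℝ ℝ).coeFn_holder (r := 2) (H1.toL3 u) (D12.toL6 φ)
  filter_upwards [h, H1.coeFn_toL3 u] with x hx hx'
  rw [mulL, ContinuousLinearMap.bilinearComp_apply, ContinuousLinearMap.holderL_apply_apply, hx,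
    hx']
  rfl

theorem integrable_mulL_mulL (u v : H1) (φ ψ : D12) :
    Integrable fun x => (u.fn x * φ.fn x) * (v.fn x * ψ.fn x) := by
  refine ((Lp.memLp (mulL u φ)).integrable_mul (Lp.memLp (mulL v ψ))).congr ?_
  filter_upwards [coeFn_mulL u φ, coeFn_mulL v ψ] with x hx hx'
  rw [Pi.mul_apply, hx, hx']

theorem integrable_mul_mulL (u v : H1) (ψ : D12) :
    Integrable fun x => u.fn x * (v.fn x * ψ.fn x) := by
  refine (u.memLp_two.integrable_mul (Lp.memLp (mulL v ψ))).congr ?_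
  filter_upwards [coeFn_mulL v ψ] with x hx
  rw [Pi.mul_apply, hx]

theorem inner_mulL_mulL (u v : H1) (φ ψ : D12) :
    ⟪mulL u φ, mulL v ψ⟫_ℝ = ∫ x, (u.fn x * φ.fn x) * (v.fn x * ψ.fn x) := by
  rw [L2.inner_def]
  refine integral_congr_ae ?_
  filter_upwards [coeFn_mulL u φ, coeFn_mulL v ψ] with x hx hx'
  rw [hx, hx', real_inner_eq_re_inner, RCLike.inner_apply]
  simp [mul_comm]

theorem inner_toL2_mulL (u v : H1) (ψ : D12) :
    ⟪H1.toL2 u, mulL v ψ⟫_ℝ = ∫ x, u.fn x * (v.fn x * ψ.fn x) := by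
  rw [L2.inner_def]
  refine integral_congr_ae ?_
  filter_upwards [coeFn_mulL v ψ] with x hx
  rw [hx, H1.coe_toL2, RCLike.inner_apply]
  simp [mul_comm]

theorem inner_toL2_toL2 (u v : H1) : ⟪H1.toL2 u, H1.toL2 v⟫_ℝ = ∫ x, u.fn x * v.fn x := by
  rw [L2.inner_def]
  refine integral_congr_ae (.of_forall fun x => ?_)
  simp [H1.coe_toL2, mul_comm]

/-! ### The abstract field equation and its reduced functional. -/

section Hilbert

variable {E D H F : Type*} [NormedAddCommGroup E] [NormedSpace ℝ E]
  [NormedAddCommGroup D] [NormedSpace ℝ D]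
  [NormedAddCommGroup H] [InnerProductSpace ℝ H]
  [NormedAddCommGroup F] [InnerProductSpace ℝ F]

/-- Riesz representation for the inner product pulled back by an operator bounded below. -/
theorem exists_inner_eq_of_antilipschitz [CompleteSpace D] [CompleteSpace H]
    {L : D →L[ℝ] H} {c : ℝ≥0} (hL : AntilipschitzWith c L)
    (l : D →L[ℝ] ℝ) : ∃ x, ∀ y, ⟪L x, L y⟫_ℝ = l y := by
  -- `D` is only a Banach space; Riesz is applied on the closed range of `L`, a Hilbert space
  -- isomorphic to it.
  have hcl : IsClosed (L.range : Set H) := 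
    hL.isClosed_range L.uniformContinuous
  have : CompleteSpace L.range := hcl.completeSpace_coe
  let e : D ≃L[ℝ] L.range := L.equivRange hL.injective hcl
  obtain ⟨x, hx⟩ := e.surjective
    ((InnerProductSpace.toDual ℝ L.range).symm (l.comp (e.symm : L.range →L[ℝ] D)))
  refine ⟨x, fun y => ?_⟩
  have h := InnerProductSpace.toDual_symm_apply (x := e y)
    (y := l.comp (e.symm : L.range →L[ℝ] D))
  rw [← hx] at h
  have hL (z : D) : (e z : H) = L z := rfl
  rw [← hL, ← hL, ← Submodule.coe_inner, h]
  simp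

variable (ι : E →L[ℝ] F) (P : E →L[ℝ] D →L[ℝ] F) (G : D →L[ℝ] H) (q : ℝ)

/-- `Φ` is a weak solution of `G†G Φ + q² (P u)† (P u) Φ = q (P u)† (ι u)`. -/
def SolvesField (u : E) (Φ : D) : Prop :=
  ∀ ψ, ⟪G Φ, G ψ⟫_ℝ + q ^ 2 * ⟪P u Φ, P u ψ⟫_ℝ = q * ⟪ι u, P u ψ⟫_ℝ

variable {ι P G q}

/-- The left side of the equation is the inner product pulled back by `(G, q P u)`, which is bounded
below because `G` is. -/
theorem SolvesField.exists [CompleteSpace D] [CompleteSpace H] [CompleteSpace F]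
    {c : ℝ≥0} (hG : AntilipschitzWith c G) (u : E) :
    ∃ Φ, SolvesField ι P G q u Φ := by
  let L : D →L[ℝ] WithLp 2 (H × F) :=
    ((WithLp.prodContinuousLinearEquiv 2 ℝ H F).symm : H × F →L[ℝ] WithLp 2 (H × F)).comp
      (G.prod (q • P u))
  have hinner (x y : D) : ⟪L x, L y⟫_ℝ = ⟪G x, G y⟫_ℝ + q ^ 2 * ⟪P u x, P u y⟫_ℝ := by
    simp only [L, WithLp.prod_inner_apply]
    simp [real_inner_smul_left, real_inner_smul_right]
    ring
  have hL : AntilipschitzWith c L := by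
    refine L.antilipschitz_of_bound fun x => ?_
    have h1 : ‖x‖ ≤ c * ‖G x‖ := by simpa using hG.le_mul_dist x 0
    refine h1.trans ?_
    gcongr
    refine le_of_sq_le_sq ?_ (norm_nonneg _)
    rw [← real_inner_self_eq_norm_sq, ← real_inner_self_eq_norm_sq, hinner]
    have := real_inner_self_nonneg (x := P u x)
    nlinarith [sq_nonneg q]
  obtain ⟨Φ, hΦ⟩ := exists_inner_eq_of_antilipschitz hL (q • (innerSL ℝ (ι u)).comp (P u))
  refine ⟨Φ, fun ψ => ?_⟩
  rw [← hinner, hΦ]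
  simp

theorem SolvesField.unique (hG : Function.Injective G) {u : E} {Φ Ψ : D}
    (hΦ : SolvesField ι P G q u Φ) (hΨ : SolvesField ι P G q u Ψ) : Φ = Ψ := by
  have h1 := hΦ (Φ - Ψ)
  rw [← hΨ (Φ - Ψ)] at h1
  have h2 : ⟪G (Φ - Ψ), G (Φ - Ψ)⟫_ℝ + q ^ 2 * ⟪P u (Φ - Ψ), P u (Φ - Ψ)⟫_ℝ = 0 := by
    rw [map_sub G, map_sub (P u), inner_sub_left, inner_sub_left, ← map_sub G, ← map_sub (P u)]
    linarith
  have h3 := real_inner_self_nonneg (x := P u (Φ - Ψ))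
  have h4 := real_inner_self_nonneg (x := G (Φ - Ψ))
  have h5 : ⟪G (Φ - Ψ), G (Φ - Ψ)⟫_ℝ = 0 := by nlinarith [sq_nonneg q]
  rw [inner_self_eq_zero] at h5
  exact sub_eq_zero.1 (hG (h5.trans (map_zero G).symm))

/-- The reduced functional is differentiable, and only its explicit dependence on `u`
contributes to the derivative. -/
theorem SolvesField.hasFDerivAt {c : ℝ≥0} (hG : AntilipschitzWith c G) {Φ : E → D}
    (hΦ : ∀ u, SolvesField ι P G q u (Φ u)) (u : E) :
    HasFDerivAt (fun u => (1 / 2) * (‖ι u‖ ^ 2 - q * ⟪ι u, P u (Φ u)⟫_ℝ))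
      ((innerSL ℝ (ι u - q • P u (Φ u))).comp (ι - q • P.flip (Φ u))) u := by
  set T : E →L[ℝ] F := ι - q • P.flip (Φ u) with hT
  have hTa (v : E) : T v = ι v - q • P v (Φ u) := by simp [hT]
  -- Twice the excess of the energy at `v` when the minimizer `Φ v` is replaced by `Φ u`; see `hK`.
  let ρ : E → ℝ := fun v => ‖G (Φ v - Φ u)‖ ^ 2 + q ^ 2 * ‖P v (Φ v - Φ u)‖ ^ 2
  -- The equations at `v` and at `u`, both tested with `Φ v - Φ u`, are subtracted; every remaining
  -- term has a factor `v - u`.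
  have hρ (v : E) : ρ v = q * ⟪T (v - u), P v (Φ v - Φ u)⟫_ℝ
      + q * ⟪T u, P (v - u) (Φ v - Φ u)⟫_ℝ := by
    have h1 := hΦ v (Φ v - Φ u)
    have h2 := hΦ u (Φ v - Φ u)
    simp only [ρ, ← real_inner_self_eq_norm_sq]
    simp only [map_sub, hTa, sub_apply, inner_sub_left, inner_sub_right, real_inner_smul_left]
      at h1 h2 ⊢
    linear_combination h1 - h2
  have hG' (x : D) : ‖x‖ ≤ c * ‖G x‖ := by simpa using hG.le_mul_dist x 0
  have hbound : ∀ᶠ v in 𝓝 u, ‖ρ v‖ ≤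
      ((|q| * (‖T‖ * (‖P‖ * (‖u‖ + 1)) + ‖T u‖ * ‖P‖)) * c) ^ 2 * ‖‖v - u‖ ^ 2‖ := by
    filter_upwards [Metric.ball_mem_nhds u one_pos] with v hv
    have hv1 : ‖v‖ ≤ ‖u‖ + 1 := by
      have := norm_sub_norm_le v u
      rw [mem_ball_iff_norm] at hv
      linarith
    set M := |q| * (‖T‖ * (‖P‖ * (‖u‖ + 1)) + ‖T u‖ * ‖P‖)
    set δ := Φ v - Φ u
    have h0 : 0 ≤ ρ v := by positivity
    have h1 : ‖G δ‖ ^ 2 ≤ ρ v := le_add_of_nonneg_right (by positivity)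
    have e1 : |⟪T (v - u), P v δ⟫_ℝ| ≤ (‖T‖ * ‖v - u‖) * (‖P‖ * (‖u‖ + 1) * ‖δ‖) := by
      refine (abs_real_inner_le_norm _ _).trans ?_
      gcongr
      · exact T.le_opNorm _
      · exact (P.le_opNorm₂ _ _).trans (by gcongr)
    have e2 : |⟪T u, P (v - u) δ⟫_ℝ| ≤ ‖T u‖ * (‖P‖ * ‖v - u‖ * ‖δ‖) := by
      refine (abs_real_inner_le_norm _ _).trans ?_
      gcongr
      exact P.le_opNorm₂ _ _
    have h2 : ρ v ≤ M * ‖v - u‖ * ‖δ‖ := by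
      rw [hρ]
      calc _ ≤ |q| * |⟪T (v - u), P v δ⟫_ℝ| + |q| * |⟪T u, P (v - u) δ⟫_ℝ| := by
            rw [← abs_mul, ← abs_mul]
            exact add_le_add (le_abs_self _) (le_abs_self _)
        _ ≤ |q| * ((‖T‖ * ‖v - u‖) * (‖P‖ * (‖u‖ + 1) * ‖δ‖))
            + |q| * (‖T u‖ * (‖P‖ * ‖v - u‖ * ‖δ‖)) := by gcongr
        _ = _ := by ring
    have h3 : ρ v ≤ (M * c * ‖v - u‖) * ‖G δ‖ := by
      refine h2.trans ?_
      calc _ ≤ M * ‖v - u‖ * (c * ‖G δ‖) := by gcongr; exact hG' δ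
        _ = _ := by ring
    -- Since `‖G δ‖² ≤ ρ v`, one factor `‖G δ‖` cancels in `h3`. So `Φ` is Lipschitz at `u`, and `ρ`
    -- is quadratically small.
    have h4 : ‖G δ‖ ≤ M * c * ‖v - u‖ := by
      rcases (norm_nonneg (G δ)).eq_or_lt with h | h
      · rw [← h]; positivity
      · nlinarith
    rw [Real.norm_of_nonneg h0, Real.norm_of_nonneg (by positivity), ← mul_pow, sq]
    exact h3.trans (by gcongr)
  have hd : HasFDerivAt ρ (0 : E →L[ℝ] ℝ) u :=
    (Asymptotics.IsBigO.of_bound _ hbound).hasFDerivAt one_lt_two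
  -- Completing the square, by the equation at `v` tested with `Φ v` and with `Φ u`. Only `‖T v‖²`
  -- contributes to the derivative.
  have hK (v : E) : (1 / 2) * (‖ι v‖ ^ 2 - q * ⟪ι v, P v (Φ v)⟫_ℝ)
      = (1 / 2) * (‖T v‖ ^ 2 + ‖G (Φ u)‖ ^ 2 - ρ v) := by
    have h1 := hΦ v (Φ v)
    have h2 := hΦ v (Φ u)
    simp only [ρ, ← real_inner_self_eq_norm_sq]
    simp only [map_sub, hTa, inner_sub_left, inner_sub_right, real_inner_smul_left,
      real_inner_smul_right, real_inner_comm (P v (Φ u)) (ι v),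
      real_inner_comm (P v (Φ u)) (P v (Φ v)), real_inner_comm (G (Φ u)) (G (Φ v))] at h1 h2 ⊢
    linear_combination (1 / 2) * h1 - h2
  simp_rw [hK]
  have h5 := (((T.hasFDerivAt (x := u)).norm_sq.add_const (‖G (Φ u)‖ ^ 2)).sub hd).const_mul (1 / 2)
  refine h5.congr_fderiv ?_
  ext v
  simp [← hTa]

end Hilbert

/-! ### Differentiability of `∫ W(u)` and of `J`. -/

section Superposition

theorem lintegral_enorm_mul_le {α : Type*} [MeasurableSpace α] {μ : Measure α} {f g : α → ℝ}
    (hf : AEStronglyMeasurable f μ) (hg : AEStronglyMeasurable g μ) (p q : ℝ≥0∞)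
    [ENNReal.HolderConjugate p q] :
    ∫⁻ x, ‖f x‖ₑ * ‖g x‖ₑ ∂μ ≤ eLpNorm f p μ * eLpNorm g q μ := by
  have h := eLpNorm_smul_le_mul_eLpNorm (p := p) (q := q) (r := 1) hg hf
  rw [eLpNorm_one_eq_lintegral_enorm] at h
  simpa [enorm_mul] using h

theorem ENNReal.holderConjugate_six_fifths_six : ENNReal.HolderConjugate (6 / 5) 6 := by
  refine ⟨?_⟩
  have h5 : (6 / 5 : ℝ≥0∞) ≠ ∞ := ENNReal.div_ne_top (by simp) (by simp)
  have h6 : (6 / 5 : ℝ≥0∞)⁻¹ ≠ ∞ := by simp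
  rw [← ENNReal.toReal_eq_toReal_iff' (by finiteness) (by simp),
    ENNReal.toReal_add h6 (by simp)]
  simp only [ENNReal.toReal_inv, ENNReal.toReal_ofNat, ENNReal.toReal_div, ENNReal.toReal_one]
  norm_num

theorem lintegral_enorm_pow_five_mul_le {α : Type*} [MeasurableSpace α] {μ : Measure α}
    {f g : α → ℝ} (hf : AEStronglyMeasurable f μ) (hg : AEStronglyMeasurable g μ) :
    ∫⁻ x, ‖f x‖ₑ ^ 5 * ‖g x‖ₑ ∂μ ≤ eLpNorm f 6 μ ^ 5 * eLpNorm g 6 μ := by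
  have := ENNReal.holderConjugate_six_fifths_six
  have h := lintegral_enorm_mul_le (f := fun x => ‖f x‖ ^ (5 : ℝ))
    (hf.norm.aemeasurable.pow_const _).aestronglyMeasurable hg (6 / 5) 6
  have e : (6 / 5 : ℝ≥0∞) * ENNReal.ofReal 5 = 6 := by
    rw [ENNReal.ofReal_ofNat]
    exact ENNReal.div_mul_cancel (by simp) (by simp)
  rw [eLpNorm_norm_rpow _ (by norm_num), e] at h
  simpa [Real.enorm_rpow_of_nonneg] using h

theorem eLpNorm_natCast_pow {α : Type*} [MeasurableSpace α] (μ : Measure α) (f : α → ℝ) {n : ℕ}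
    (hn : n ≠ 0) : eLpNorm f n μ ^ n = ∫⁻ x, ‖f x‖ₑ ^ n ∂μ := by
  have h := eLpNorm_nnreal_pow_eq_lintegral (f := f) (μ := μ) (p := (n : ℝ≥0))
    (by exact_mod_cast hn)
  simpa using h

/-- The identity on small and on large arguments, and zero in between. -/
noncomputable def tailPart (n : ℕ) (s : ℝ) : ℝ :=
  {s : ℝ | |s| < 1 / (n + 1) ∨ (n : ℝ) < |s|}.indicator id s

theorem measurable_tailPart (n : ℕ) : Measurable (tailPart n) :=
  measurable_id.indicator ((measurableSet_lt measurable_id.abs measurable_const).union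
    (measurableSet_lt measurable_const measurable_id.abs))

theorem enorm_tailPart_le (n : ℕ) (s : ℝ) : ‖tailPart n s‖ₑ ≤ ‖s‖ₑ :=
  enorm_indicator_le_enorm_self _ _

theorem tailPart_tendsto (s : ℝ) : Tendsto (fun n => tailPart n s) atTop (𝓝 0) := by
  by_cases hs : s = 0
  · have h0 (n : ℕ) : tailPart n s = 0 := by
      subst hs
      simp [tailPart, indicator]
    simp [h0]
  · refine tendsto_const_nhds.congr' ?_
    obtain ⟨N, hN⟩ := exists_nat_ge |s|
    have h1 : ∀ᶠ n : ℕ in atTop, 1 / ((n : ℝ) + 1) < |s| :=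
      tendsto_one_div_add_atTop_nhds_zero_nat.eventually (gt_mem_nhds (abs_pos.2 hs))
    filter_upwards [h1, eventually_ge_atTop N] with n hn hn'
    have : (N : ℝ) ≤ n := by exact_mod_cast hn'
    rw [tailPart, indicator_of_notMem]
    rintro (h | h) <;> linarith

/-- Dominated convergence, with `|u|^p` as majorant. -/
theorem eLpNorm_tailPart_tendsto {α : Type*} [MeasurableSpace α] {μ : Measure α} {u : α → ℝ}
    {p : ℕ} (hp : p ≠ 0) (hu : MemLp u p μ) :
    Tendsto (fun n => eLpNorm (fun x => tailPart n (u x)) p μ) atTop (𝓝 0) := by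
  have h : Tendsto (fun n => ∫⁻ x, ‖tailPart n (u x)‖ₑ ^ p ∂μ) atTop (𝓝 (∫⁻ _, 0 ∂μ)) := by
    refine tendsto_lintegral_of_dominated_convergence' (fun x => ‖u x‖ₑ ^ p) (fun n => ?_)
      (fun n => .of_forall fun x => ?_) ?_ (.of_forall fun x => ?_)
    · exact (((measurable_tailPart n).comp_aemeasurable hu.1.aemeasurable).enorm).pow_const _
    · exact pow_le_pow_left₀ zero_le (enorm_tailPart_le n (u x)) p
    · rw [← eLpNorm_natCast_pow μ u hp]
      exact ENNReal.pow_ne_top hu.2.ne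
    · have := ENNReal.Tendsto.pow (n := p) (tailPart_tendsto (u x)).enorm
      simpa [hp] using this
  simp_rw [← eLpNorm_natCast_pow μ _ hp, lintegral_zero] at h
  have h2 := h.ennrpow_const (1 / (p : ℝ))
  have h3 (a : ℝ≥0∞) : (a ^ p) ^ (1 / (p : ℝ)) = a := by
    rw [← ENNReal.rpow_natCast, ← ENNReal.rpow_mul, mul_one_div_cancel (by exact_mod_cast hp),
      ENNReal.rpow_one]
  simpa only [h3, ENNReal.zero_rpow_of_pos
    (one_div_pos.2 (Nat.cast_pos.2 (Nat.pos_of_ne_zero hp)) : 0 < 1 / (p : ℝ))] using h2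

variable {W : ℝ → ℝ} {C : ℝ}

/-- Mean value inequality on `[-(|s| + |t|), |s| + |t|]`. In `17 = 2⁴ + 1`, the `2⁴` comes from
convexity of the fifth power and the `1` from the term `W'(s) t`. -/
theorem abs_remainder_le (hW : ContDiff ℝ 1 W) (hC : ∀ s, |deriv W s| ≤ C * (|s| + |s| ^ 5))
    (s t : ℝ) : |W (s + t) - W s - deriv W s * t|
      ≤ 17 * |C| * (|s| + |s| ^ 5) * |t| + 17 * |C| * (|t| ^ 2 + |t| ^ 6) := by
  have hC' (s : ℝ) : |deriv W s| ≤ |C| * (|s| + |s| ^ 5) :=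
    (hC s).trans (by gcongr; exact le_abs_self C)
  have hs : |s| ≤ |s| + |t| := le_add_of_nonneg_right (abs_nonneg t)
  have hst : |s + t| ≤ |s| + |t| := abs_add_le s t
  have h1 : ‖W (s + t) - W s‖ ≤ |C| * ((|s| + |t|) + (|s| + |t|) ^ 5) * ‖s + t - s‖ := by
    refine Convex.norm_image_sub_le_of_norm_deriv_le (s := Icc (-(|s| + |t|)) (|s| + |t|))
      (fun x _ => hW.differentiable one_ne_zero x) (fun x hx => ?_) (convex_Icc _ _)
      (abs_le.1 hs) (abs_le.1 hst)
    have hx' : |x| ≤ |s| + |t| := abs_le.2 hx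
    exact (hC' x).trans (by gcongr)
  rw [add_sub_cancel_left, Real.norm_eq_abs, Real.norm_eq_abs] at h1
  have h2 : (|s| + |t|) ^ 5 ≤ 2 ^ 4 * (|s| ^ 5 + |t| ^ 5) :=
    add_pow_le (abs_nonneg s) (abs_nonneg t) 5
  calc |W (s + t) - W s - deriv W s * t| ≤ |W (s + t) - W s| + |deriv W s * t| := abs_sub _ _
    _ ≤ |C| * ((|s| + |t|) + 2 ^ 4 * (|s| ^ 5 + |t| ^ 5)) * |t|
        + |C| * (|s| + |s| ^ 5) * |t| := by
      rw [abs_mul]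
      gcongr
      · exact h1.trans (by gcongr)
      · exact hC' s
    _ ≤ _ := by
      have h3 : 0 ≤ |C| * |s| * |t| := by positivity
      have h4 : 0 ≤ |C| * |t| ^ 2 := by positivity
      have h5 : 0 ≤ |C| * |t| ^ 6 := by positivity
      linarith

theorem exists_abs_remainder_le (hW : ContDiff ℝ 1 W) (η M : ℝ) (hη : 0 < η) :
    ∃ δ > 0, ∀ s t, |s| ≤ M → |t| ≤ δ → |W (s + t) - W s - deriv W s * t| ≤ η * |t| := by
  have hd : Continuous (deriv W) := hW.continuous_deriv le_rfl
  have huc : UniformContinuousOn (deriv W) (Icc (-(M + 1)) (M + 1)) :=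
    isCompact_Icc.uniformContinuousOn_of_continuous hd.continuousOn
  obtain ⟨δ, hδ, h⟩ := Metric.uniformContinuousOn_iff.1 huc η hη
  -- The `1` keeps the points between `s` and `s + t` in `[-(M + 1), M + 1]`; the half makes the
  -- distance strictly less than `δ`.
  refine ⟨min 1 (δ / 2), by positivity, fun s t hs ht => ?_⟩
  have ht1 : |t| ≤ 1 := ht.trans (min_le_left _ _)
  have ht2 : |t| ≤ δ / 2 := ht.trans (min_le_right _ _)
  have h1 : ‖(W (s + t) - deriv W s * (s + t)) - (W s - deriv W s * s)‖ ≤ η * ‖s + t - s‖ := by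
    refine Convex.norm_image_sub_le_of_norm_hasDerivWithin_le
      (f := fun x => W x - deriv W s * x) (f' := fun x => deriv W x - deriv W s * 1)
      (s := Metric.closedBall s |t|)
      (fun x _ => (((hW.differentiable one_ne_zero x).hasDerivAt).sub
        ((hasDerivAt_id x).const_mul (deriv W s))).hasDerivWithinAt) (fun x hx => ?_)
      (convex_closedBall _ _) (Metric.mem_closedBall_self (abs_nonneg t)) (by simp)
    rw [Metric.mem_closedBall, Real.dist_eq] at hx
    have hx' : |x| ≤ M + 1 := by
      have := abs_sub_abs_le_abs_sub x s
      linarith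
    have := h x (abs_le.1 hx') s (abs_le.1 (by linarith)) (by rw [Real.dist_eq]; linarith)
    rw [Real.dist_eq] at this
    simpa using this.le
  rw [add_sub_cancel_left, Real.norm_eq_abs, Real.norm_eq_abs] at h1
  convert h1 using 2
  ring

theorem exists_abs_remainder_le_tailPart (hW : ContDiff ℝ 1 W)
    (hC : ∀ s, |deriv W s| ≤ C * (|s| + |s| ^ 5)) (n : ℕ) (ε : ℝ) (hε : 0 < ε) :
    ∃ K : ℝ, 0 ≤ K ∧ ∀ s t, |W (s + t) - W s - deriv W s * t|
      ≤ 17 * |C| * (|tailPart n s| * |t| + |tailPart n s| ^ 5 * |t|) + ε * (|s| * |t|)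
        + K * (|t| ^ 2 + |t| ^ 6) := by
  -- Off the tail `1 / (n + 1) ≤ |s|`, so this tolerance yields `ε |s| |t|`. A bare `ε |t|` would be
  -- useless, as `v` need not be in `L¹`.
  obtain ⟨δ, hδ, h⟩ := exists_abs_remainder_le hW (ε * (1 / (n + 1))) n (by positivity)
  -- The second summand handles `|s| ≤ n` with `|t| > δ`, where `|t| ≤ t² / δ`.
  refine ⟨17 * |C| + 17 * |C| * (n + (n : ℝ) ^ 5) / δ, by positivity, fun s t => ?_⟩
  have h0 := abs_remainder_le hW hC s t
  have hK : 0 ≤ 17 * |C| * (n + (n : ℝ) ^ 5) / δ := by positivity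
  have ht : 0 ≤ |t| ^ 2 + |t| ^ 6 := by positivity
  by_cases hs : |s| < 1 / ((n : ℝ) + 1) ∨ (n : ℝ) < |s|
  · have e : tailPart n s = s := indicator_of_mem (s := {s : ℝ | _}) hs id
    rw [e]
    have : 0 ≤ ε * (|s| * |t|) := by positivity
    nlinarith [mul_nonneg hK ht]
  · have e : tailPart n s = 0 := indicator_of_notMem (s := {s : ℝ | _}) hs id
    rw [e]
    push Not at hs
    have h3 : 0 ≤ 17 * |C| * (|t| ^ 2 + |t| ^ 6) := by positivity
    rcases le_or_gt |t| δ with htd | htd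
    · have h1 := h s t hs.2 htd
      have h2 : ε * (1 / (n + 1)) * |t| ≤ ε * |s| * |t| := by gcongr; exact hs.1
      simp only [abs_zero]
      nlinarith [mul_nonneg hK ht]
    · have h1 : 17 * |C| * (|s| + |s| ^ 5) * |t|
          ≤ 17 * |C| * (n + (n : ℝ) ^ 5) / δ * (|t| ^ 2 + |t| ^ 6) := by
        calc 17 * |C| * (|s| + |s| ^ 5) * |t| ≤ 17 * |C| * (n + (n : ℝ) ^ 5) * |t| := by
              gcongr <;> exact hs.2
          _ = 17 * |C| * (n + (n : ℝ) ^ 5) / δ * (δ * |t|) := by field_simp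
          _ ≤ 17 * |C| * (n + (n : ℝ) ^ 5) / δ * (|t| ^ 2 + |t| ^ 6) := by
              gcongr
              have : δ * |t| ≤ |t| * |t| := by gcongr
              nlinarith [pow_nonneg (abs_nonneg t) 6]
      have : 0 ≤ ε * (|s| * |t|) := by positivity
      simp only [abs_zero]
      nlinarith

/-- The first-order Taylor remainder of the superposition operator is small. -/
theorem exists_lintegral_remainder_le {α : Type*} [MeasurableSpace α] {μ : Measure α} {u : α → ℝ}
    (hW : ContDiff ℝ 1 W) (hC : ∀ s, |deriv W s| ≤ C * (|s| + |s| ^ 5))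
    (hu2 : MemLp u 2 μ) (hu6 : MemLp u 6 μ) (ε : ℝ≥0) (hε : 0 < ε) :
    ∃ K : ℝ≥0, ∀ v : α → ℝ, AEStronglyMeasurable v μ →
      ∫⁻ x, ‖W (u x + v x) - W (u x) - deriv W (u x) * v x‖ₑ ∂μ
        ≤ ε * (eLpNorm v 2 μ + eLpNorm v 6 μ) + K * (eLpNorm v 2 μ ^ 2 + eLpNorm v 6 μ ^ 6) := by
  set c : ℝ≥0 := 17 * ‖C‖₊
  set U : ℝ≥0 := (eLpNorm u 2 μ).toNNReal
  have hU : eLpNorm u 2 μ = U := (ENNReal.coe_toNNReal hu2.2.ne).symm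
  have l2 := eLpNorm_tailPart_tendsto (p := 2) two_ne_zero (by simpa using hu2)
  have l6 := eLpNorm_tailPart_tendsto (p := 6) (by norm_num) (by simpa using hu6)
  rw [Nat.cast_ofNat] at l2 l6
  have l2' := ENNReal.Tendsto.const_mul (a := (c : ℝ≥0∞)) l2 (Or.inr (by simp))
  have l6' := ENNReal.Tendsto.const_mul (a := (c : ℝ≥0∞)) (ENNReal.Tendsto.pow (n := 5) l6) (Or.inr (by simp))
  have hε2 : (0 : ℝ≥0∞) < ε / 2 := ENNReal.half_pos (by exact_mod_cast hε.ne')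
  simp only [mul_zero, ne_eq, OfNat.ofNat_ne_zero, not_false_eq_true, zero_pow] at l2' l6'
  -- `n` is fixed before `K`. However large `K` becomes, it multiplies only superlinear terms in
  -- `v`.
  obtain ⟨n, hn2, hn6⟩ := ((l2'.eventually (gt_mem_nhds hε2)).and
    (l6'.eventually (gt_mem_nhds hε2))).exists
  obtain ⟨K, hK0, hK⟩ := exists_abs_remainder_le_tailPart hW hC n (ε / (2 * (U + 1)))
    (by positivity)
  refine ⟨K.toNNReal, fun v hv => ?_⟩
  set f : α → ℝ := fun x => tailPart n (u x)
  have hf : AEStronglyMeasurable f μ :=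
    ((measurable_tailPart n).comp_aemeasurable hu2.1.aemeasurable).aestronglyMeasurable
  set e : ℝ≥0 := ε / (2 * (U + 1))
  have heU : e * U ≤ ε / 2 := by
    have h1 : e * (U + 1) = ε / 2 := by
      simp only [e]; field_simp
    rw [← h1]
    gcongr
    simp
  have hpt (x : α) : ‖W (u x + v x) - W (u x) - deriv W (u x) * v x‖ₑ
      ≤ c * (‖f x‖ₑ * ‖v x‖ₑ) + c * (‖f x‖ₑ ^ 5 * ‖v x‖ₑ) + e * (‖u x‖ₑ * ‖v x‖ₑ)
        + (K.toNNReal * ‖v x‖ₑ ^ 2 + K.toNNReal * ‖v x‖ₑ ^ 6) := by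
    have h := hK (u x) (v x)
    simp only [enorm_eq_nnnorm]
    norm_cast
    rw [← NNReal.coe_le_coe]
    push_cast
    rw [Real.coe_toNNReal _ hK0]
    simp only [Real.norm_eq_abs]
    refine h.trans (le_of_eq ?_)
    simp only [c, e, f, NNReal.coe_mul, coe_nnnorm, Real.norm_eq_abs]
    push_cast
    ring
  have mf := hf.enorm
  have mv := hv.enorm
  have mu := hu2.1.enorm
  have p2 : ∫⁻ x, ‖v x‖ₑ ^ 2 ∂μ = eLpNorm v 2 μ ^ 2 := by
    simpa using (eLpNorm_natCast_pow μ v two_ne_zero).symm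
  have p6 : ∫⁻ x, ‖v x‖ₑ ^ 6 ∂μ = eLpNorm v 6 μ ^ 6 := by
    simpa using (eLpNorm_natCast_pow μ v (n := 6) (by norm_num)).symm
  have m1 : AEMeasurable (fun x => (c : ℝ≥0∞) * (‖f x‖ₑ * ‖v x‖ₑ)) μ := (mf.mul mv).const_mul _
  have m2 : AEMeasurable (fun x => (c : ℝ≥0∞) * (‖f x‖ₑ ^ 5 * ‖v x‖ₑ)) μ :=
    ((mf.pow_const 5).mul mv).const_mul _
  have m3 : AEMeasurable (fun x => (e : ℝ≥0∞) * (‖u x‖ₑ * ‖v x‖ₑ)) μ := (mu.mul mv).const_mul _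
  have m12 : AEMeasurable (fun x => (c : ℝ≥0∞) * (‖f x‖ₑ * ‖v x‖ₑ)
      + c * (‖f x‖ₑ ^ 5 * ‖v x‖ₑ)) μ := m1.add m2
  have m123 : AEMeasurable (fun x => (c : ℝ≥0∞) * (‖f x‖ₑ * ‖v x‖ₑ)
      + c * (‖f x‖ₑ ^ 5 * ‖v x‖ₑ) + e * (‖u x‖ₑ * ‖v x‖ₑ)) μ := m12.add m3
  calc _ ≤ ∫⁻ x, (c * (‖f x‖ₑ * ‖v x‖ₑ) + c * (‖f x‖ₑ ^ 5 * ‖v x‖ₑ) + e * (‖u x‖ₑ * ‖v x‖ₑ)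
        + (K.toNNReal * ‖v x‖ₑ ^ 2 + K.toNNReal * ‖v x‖ₑ ^ 6)) ∂μ := lintegral_mono hpt
    _ = c * (∫⁻ x, ‖f x‖ₑ * ‖v x‖ₑ ∂μ) + c * (∫⁻ x, ‖f x‖ₑ ^ 5 * ‖v x‖ₑ ∂μ)
        + e * (∫⁻ x, ‖u x‖ₑ * ‖v x‖ₑ ∂μ)
        + (K.toNNReal * eLpNorm v 2 μ ^ 2 + K.toNNReal * eLpNorm v 6 μ ^ 6) := by
      rw [lintegral_add_left' m123, lintegral_add_left' m12,
        lintegral_add_left' m1, lintegral_add_left' ((mv.pow_const 2).const_mul _)]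
      simp only [lintegral_const_mul' _ _ ENNReal.coe_ne_top, p2, p6]
    _ ≤ c * (eLpNorm f 2 μ * eLpNorm v 2 μ) + c * (eLpNorm f 6 μ ^ 5 * eLpNorm v 6 μ)
        + e * (eLpNorm u 2 μ * eLpNorm v 2 μ)
        + (K.toNNReal * eLpNorm v 2 μ ^ 2 + K.toNNReal * eLpNorm v 6 μ ^ 6) := by
      gcongr
      · exact lintegral_enorm_mul_le hf hv 2 2
      · exact lintegral_enorm_pow_five_mul_le hf hv
      · exact lintegral_enorm_mul_le hu2.1 hv 2 2
    _ ≤ (ε / 2 * eLpNorm v 2 μ) + ε / 2 * eLpNorm v 6 μ + ε / 2 * eLpNorm v 2 μ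
        + (K.toNNReal * eLpNorm v 2 μ ^ 2 + K.toNNReal * eLpNorm v 6 μ ^ 6) := by
      rw [← mul_assoc, ← mul_assoc, ← mul_assoc]
      gcongr
      rw [hU]
      calc ((e : ℝ≥0∞) * U) = ((e * U : ℝ≥0) : ℝ≥0∞) := by push_cast; rfl
        _ ≤ ((ε / 2 : ℝ≥0) : ℝ≥0∞) := by exact_mod_cast heU
        _ = ε / 2 := by rw [ENNReal.coe_div two_ne_zero]; rfl
    _ = ε / 2 * eLpNorm v 6 μ + ε * eLpNorm v 2 μ
        + (K.toNNReal * eLpNorm v 2 μ ^ 2 + K.toNNReal * eLpNorm v 6 μ ^ 6) := by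
      nth_rw 5 [← ENNReal.add_halves (ε : ℝ≥0∞)]
      ring
    _ ≤ _ := by
      rw [mul_add, mul_add, add_comm (ε / 2 * eLpNorm v 6 μ)]
      gcongr
      exact ENNReal.half_le_self

theorem abs_le_of_growth (hW : ContDiff ℝ 1 W) (hW0 : W 0 = 0)
    (hC : ∀ s, |deriv W s| ≤ C * (|s| + |s| ^ 5)) (s : ℝ) :
    |W s| ≤ 17 * |C| * (|s| ^ 2 + |s| ^ 6) := by
  -- With `W(0) = W'(0) = 0`, `W s` is its own Taylor remainder at `0`.
  have h0 : deriv W 0 = 0 := by simpa using hC 0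
  simpa [hW0, h0] using abs_remainder_le hW hC 0 s

end Superposition

section Superposition

variable {W : ℝ → ℝ} {C : ℝ}

theorem lintegral_deriv_mul_le {α : Type*} [MeasurableSpace α] {μ : Measure α} {u v : α → ℝ}
    (hC : ∀ s, |deriv W s| ≤ C * (|s| + |s| ^ 5))
    (hu : AEStronglyMeasurable u μ) (hv : AEStronglyMeasurable v μ) :
    ∫⁻ x, ‖deriv W (u x) * v x‖ₑ ∂μ
      ≤ ‖C‖ₑ * (eLpNorm u 2 μ * eLpNorm v 2 μ + eLpNorm u 6 μ ^ 5 * eLpNorm v 6 μ) := by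
  have hpt (x : α) : ‖deriv W (u x) * v x‖ₑ
      ≤ ‖C‖ₑ * (‖u x‖ₑ * ‖v x‖ₑ + ‖u x‖ₑ ^ 5 * ‖v x‖ₑ) := by
    simp only [enorm_eq_nnnorm]
    norm_cast
    rw [← NNReal.coe_le_coe]
    push_cast
    simp only [Real.norm_eq_abs, abs_mul]
    calc |deriv W (u x)| * |v x| ≤ |C| * (|u x| + |u x| ^ 5) * |v x| := by
          gcongr
          exact (hC _).trans (by gcongr; exact le_abs_self C)
      _ = _ := by ring
  refine (lintegral_mono hpt).trans ?_
  have huv : AEMeasurable (fun x => ‖u x‖ₑ * ‖v x‖ₑ) μ := hu.enorm.mul hv.enorm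
  rw [lintegral_const_mul' _ _ enorm_ne_top, lintegral_add_left' huv]
  gcongr
  · exact lintegral_enorm_mul_le hu hv 2 2
  · exact lintegral_enorm_pow_five_mul_le hu hv

theorem integrable_comp_of_growth {α : Type*} [MeasurableSpace α] {μ : Measure α} {u : α → ℝ}
    (hW : ContDiff ℝ 1 W) (hW0 : W 0 = 0) (hC : ∀ s, |deriv W s| ≤ C * (|s| + |s| ^ 5))
    (hu2 : MemLp u 2 μ) (hu6 : MemLp u 6 μ) : Integrable (fun x => W (u x)) μ := by
  have h2 : Integrable (fun x => |u x| ^ 2) μ := by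
    simpa using hu2.integrable_norm_pow (p := 2) two_ne_zero
  have h6 : Integrable (fun x => |u x| ^ 6) μ := by
    simpa using hu6.integrable_norm_pow (p := 6) (by norm_num)
  exact ((h2.add h6).const_mul (17 * |C|)).mono'
    (hW.continuous.comp_aestronglyMeasurable hu2.1)
    (.of_forall fun x => abs_le_of_growth hW hW0 hC (u x))

theorem exists_lintegral_deriv_mul_le (hC : ∀ s, |deriv W s| ≤ C * (|s| + |s| ^ 5))
    (u : H1) : ∃ B : ℝ≥0, ∀ v : H1,
    ∫⁻ x, ‖deriv W (u.fn x) * v.fn x‖ₑ ≤ B * ‖v‖ₑ := by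
  have hB : ‖C‖ₑ * (eLpNorm u.fn 2 volume + eLpNorm u.fn 6 volume ^ 5) * H1.embConst ≠ ∞ := by
    have := u.memLp_two.2.ne
    have := u.memLp_six.2.ne
    finiteness
  lift ‖C‖ₑ * (eLpNorm u.fn 2 volume + eLpNorm u.fn 6 volume ^ 5) * H1.embConst to ℝ≥0
    using hB with B hB'
  refine ⟨B, fun v => (lintegral_deriv_mul_le hC u.memLp_two.1 v.memLp_two.1).trans ?_⟩
  rw [hB', mul_assoc, mul_assoc, add_mul]
  gcongr
  exacts [v.eLpNorm_two_le', v.eLpNorm_six_le]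

theorem integrable_deriv_mul (hW : ContDiff ℝ 1 W)
    (hC : ∀ s, |deriv W s| ≤ C * (|s| + |s| ^ 5)) (u v : H1) :
    Integrable fun x => deriv W (u.fn x) * v.fn x := by
  obtain ⟨B, hB⟩ := exists_lintegral_deriv_mul_le hC u
  exact ⟨((hW.continuous_deriv le_rfl).comp_aestronglyMeasurable u.memLp_two.1).mul
    v.memLp_two.1, (hB v).trans_lt (by finiteness)⟩

theorem exists_hasFDerivAt_integral_comp (hW : ContDiff ℝ 1 W)
    (hC : ∀ s, |deriv W s| ≤ C * (|s| + |s| ^ 5)) (hW0 : W 0 = 0) (u : H1) : ∃ L : H1 →L[ℝ] ℝ,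
    (∀ v, L v = ∫ x, deriv W (u.fn x) * v.fn x) ∧
      HasFDerivAt (fun u : H1 => ∫ x, W (u.fn x)) L u := by
  obtain ⟨B, hB⟩ := exists_lintegral_deriv_mul_le hC u
  have hi (v : H1) := integrable_deriv_mul hW hC u v
  let L : H1 →L[ℝ] ℝ := LinearMap.mkContinuous
    { toFun := fun v => ∫ x, deriv W (u.fn x) * v.fn x
      map_add' := fun v w => by
        rw [← integral_add (hi v) (hi w)]
        refine integral_congr_ae ?_
        filter_upwards [H1.fn_add v w] with x hx
        rw [hx, Pi.add_apply, mul_add]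
      map_smul' := fun c v => by
        rw [RingHom.id_apply, smul_eq_mul, ← integral_const_mul]
        refine integral_congr_ae ?_
        filter_upwards [H1.fn_smul c v] with x hx
        rw [hx, Pi.smul_apply, smul_eq_mul]
        ring } B fun v => by
    have h := (enorm_integral_le_lintegral_enorm _).trans (hB v)
    have := ENNReal.toReal_mono (by finiteness) h
    simpa using this
  have hL (v : H1) : L v = ∫ x, deriv W (u.fn x) * v.fn x := rfl
  refine ⟨L, hL, ?_⟩
  rw [hasFDerivAt_iff_isLittleO_nhds_zero, Asymptotics.isLittleO_iff]
  intro c hc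
  have he : (0 : ℝ≥0) < H1.embConst := lt_of_lt_of_le one_pos (le_max_left _ _)
  -- The `L²` and `L⁶` norms of `h` are each at most `embConst * ‖h‖`, so the linear part costs `c /
  -- 2 * ‖h‖`; `hlim` provides the other half.
  obtain ⟨K, hK⟩ := exists_lintegral_remainder_le hW hC u.memLp_two u.memLp_six
    (c.toNNReal / (4 * H1.embConst)) (by have := Real.toNNReal_pos.2 hc; positivity)
  have hlim : Tendsto (fun h : H1 => (K : ℝ) * (H1.embConst ^ 2 * ‖h‖ + H1.embConst ^ 6 * ‖h‖ ^ 5))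
      (𝓝 0) (𝓝 0) := by
    have : Continuous fun h : H1 =>
        (K : ℝ) * (H1.embConst ^ 2 * ‖h‖ + H1.embConst ^ 6 * ‖h‖ ^ 5) := by fun_prop
    simpa using this.tendsto 0
  filter_upwards [hlim.eventually (gt_mem_nhds (half_pos hc))] with h hh
  have e1 : (∫ x, W ((u + h).fn x)) - (∫ x, W (u.fn x)) - L h
      = ∫ x, (W (u.fn x + h.fn x) - W (u.fn x) - deriv W (u.fn x) * h.fn x) := by
    have iW (w : H1) := integrable_comp_of_growth hW hW0 hC w.memLp_two w.memLp_six
    have iWW : Integrable fun x => W ((u + h).fn x) - W (u.fn x) := (iW _).sub (iW _)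
    rw [hL, ← integral_sub (iW _) (iW _), ← integral_sub iWW (hi h)]
    refine integral_congr_ae ?_
    filter_upwards [H1.fn_add u h] with x hx
    rw [hx, Pi.add_apply]
  have h1 : ‖(∫ x, W ((u + h).fn x)) - (∫ x, W (u.fn x)) - L h‖ₑ
      ≤ (c.toNNReal / (4 * H1.embConst) : ℝ≥0)
          * (H1.embConst * ‖h‖ₑ + H1.embConst * ‖h‖ₑ)
        + K * ((H1.embConst * ‖h‖ₑ) ^ 2 + (H1.embConst * ‖h‖ₑ) ^ 6) := by
    rw [e1]
    refine (enorm_integral_le_lintegral_enorm _).trans ((hK _ h.memLp_two.1).trans ?_)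
    gcongr
    exacts [h.eLpNorm_two_le', h.eLpNorm_six_le, h.eLpNorm_two_le', h.eLpNorm_six_le]
  have h2 : ‖(∫ x, W ((u + h).fn x)) - (∫ x, W (u.fn x)) - L h‖
      ≤ c / (4 * H1.embConst) * (H1.embConst * ‖h‖ + H1.embConst * ‖h‖)
        + K * ((H1.embConst * ‖h‖) ^ 2 + (H1.embConst * ‖h‖) ^ 6) := by
    simp only [enorm_eq_nnnorm] at h1
    norm_cast at h1
    rw [← NNReal.coe_le_coe] at h1
    push_cast at h1
    rwa [Real.coe_toNNReal _ hc.le] at h1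
  refine h2.trans ?_
  have he' : (0 : ℝ) < H1.embConst := he
  have e2 : c / (4 * H1.embConst) * (H1.embConst * ‖h‖ + H1.embConst * ‖h‖) = c / 2 * ‖h‖ := by
    field_simp
    ring
  rw [e2]
  nlinarith [norm_nonneg h, mul_le_mul_of_nonneg_right hh.le (norm_nonneg h)]

theorem inner_gradL_gradL (u v : H1) :
    ⟪H1.gradL u, H1.gradL v⟫_ℝ = ∫ x, ⟪u.grad x, v.grad x⟫_ℝ := rfl

theorem exists_hasFDerivAt_J (hW : ContDiff ℝ 1 W)
    (hC : ∀ s, |deriv W s| ≤ C * (|s| + |s| ^ 5)) (hW0 : W 0 = 0) (u : H1) : ∃ L : H1 →L[ℝ] ℝ,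
    (∀ v, L v = (∫ x, ⟪u.grad x, v.grad x⟫_ℝ) + ∫ x, deriv W (u.fn x) * v.fn x) ∧
      HasFDerivAt (J W) L u := by
  obtain ⟨L, hL, hd⟩ := exists_hasFDerivAt_integral_comp hW hC hW0 u
  have hJ : J W = fun u => (1 / 2) * ‖H1.gradL u‖ ^ 2 + ∫ x, W (u.fn x) := by
    funext u
    have h2 : Integrable fun x => ‖u.grad x‖ ^ 2 :=
      (Lp.memLp (H1.gradL u)).integrable_norm_pow two_ne_zero
    rw [J, integral_add (h2.const_mul _)
      (integrable_comp_of_growth hW hW0 hC u.memLp_two u.memLp_six), integral_const_mul,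
      ← real_inner_self_eq_norm_sq, inner_gradL_gradL]
    simp_rw [real_inner_self_eq_norm_sq]
  have h := (((H1.gradL.hasFDerivAt (x := u)).norm_sq).const_mul (1 / 2)).add hd
  rw [hJ]
  refine ⟨_, fun v => ?_, h⟩
  simp [hL, ← inner_gradL_gradL]

end Superposition

/-! ### Back to the Klein-Gordon-Maxwell system. -/

/-- The integrability clauses are automatic, since `u`, `uΦ` and `uψ` lie in `L²`. -/
theorem solvesPhi_iff {q : ℝ} {u : H1} {Φ : D12} :
    SolvesPhi q u Φ ↔ SolvesField H1.toL2 mulL D12.gradL q u Φ := by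
  refine forall_congr' fun ψ => ?_
  have e1 (x : R3) : u.fn x * Φ.fn x * (u.fn x * ψ.fn x) = u.fn x ^ 2 * Φ.fn x * ψ.fn x := by ring
  have e2 (x : R3) : u.fn x * (u.fn x * ψ.fn x) = u.fn x ^ 2 * ψ.fn x := by ring
  have i1 := integrable_mulL_mulL u u Φ ψ
  have i2 := integrable_mul_mulL u u ψ
  have e3 : ⟪D12.gradL Φ, D12.gradL ψ⟫_ℝ = ∫ x, ⟪Φ.grad x, ψ.grad x⟫_ℝ := rfl
  rw [inner_mulL_mulL, inner_toL2_mulL, e3]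
  simp only [e1, e2] at i1 i2 ⊢
  simp [i1, i2]

theorem existsUnique_solvesPhi (q : ℝ) (u : H1) : ∃! Φ : D12, SolvesPhi q u Φ := by
  obtain ⟨Φ, hΦ⟩ := SolvesField.exists (ι := H1.toL2) (P := mulL) (q := q)
    D12.antilipschitz_gradL u
  exact ⟨Φ, solvesPhi_iff.2 hΦ, fun Ψ hΨ =>
    (solvesPhi_iff.1 hΨ).unique D12.antilipschitz_gradL.injective hΦ⟩

theorem solvesPhi_Phi (q : ℝ) (u : H1) : SolvesPhi q u (Phi q u) := by
  have h := (existsUnique_solvesPhi q u).exists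
  rw [Phi, dif_pos h]
  exact h.choose_spec

/-- `(1 - q Φ) u` as an element of `L²`. -/
theorem coeFn_toL2_sub_smul_mulL (q : ℝ) (u : H1) (Φ : D12) :
    H1.toL2 u - q • mulL u Φ =ᵐ[volume] fun x => (1 - q * Φ.fn x) * u.fn x := by
  filter_upwards [Lp.coeFn_sub (H1.toL2 u) (q • mulL u Φ), Lp.coeFn_smul q (mulL u Φ),
    coeFn_mulL u Φ] with x h1 h2 h3
  rw [h1, Pi.sub_apply, h2, Pi.smul_apply, h3, H1.coe_toL2, smul_eq_mul]
  ring

theorem K_eq (q : ℝ) :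
    K q = fun u => (1 / 2) * (‖H1.toL2 u‖ ^ 2 - q * ⟪H1.toL2 u, mulL u (Phi q u)⟫_ℝ) := by
  funext u
  have h2 : Integrable fun x => u.fn x * u.fn x := u.memLp_two.integrable_mul u.memLp_two
  rw [← real_inner_self_eq_norm_sq, inner_toL2_toL2, inner_toL2_mulL, K,
    ← integral_const_mul q, ← integral_sub h2 ((integrable_mul_mulL u u (Phi q u)).const_mul q)]
  congr 2 with x
  ring

theorem hasFDerivAt_K (q : ℝ) (u : H1) :
    HasFDerivAt (K q) ((innerSL ℝ (H1.toL2 u - q • mulL u (Phi q u))).comp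
      (H1.toL2 - q • mulL.flip (Phi q u))) u := by
  have h := SolvesField.hasFDerivAt (ι := H1.toL2) (P := mulL) (q := q) (Φ := Phi q)
    D12.antilipschitz_gradL (fun u => solvesPhi_iff.1 (solvesPhi_Phi q u)) u
  exact h.congr_of_eventuallyEq (.of_forall fun v => congrFun (K_eq q) v)

theorem fderiv_K_apply (q : ℝ) (u v : H1) :
    fderiv ℝ (K q) u v
      = ⟪H1.toL2 u - q • mulL u (Phi q u), H1.toL2 v - q • mulL v (Phi q u)⟫_ℝ :=
  DFunLike.congr_fun (hasFDerivAt_K q u).fderiv v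

theorem D12.fn_smul (c : ℝ) (φ : D12) : (c • φ).fn =ᵐ[volume] c • φ.fn :=
  Lp.coeFn_smul c (D12.toL6 φ)

theorem D12.grad_smul (c : ℝ) (φ : D12) : (c • φ).grad =ᵐ[volume] c • φ.grad :=
  Lp.coeFn_smul c (D12.gradL φ)

theorem solvesGauss_smul_Phi (q : ℝ) (u : H1) (ω : ℝ) :
    SolvesGauss q u (ω • Phi q u) ω := by
  intro ψ
  obtain ⟨i1, i2, h⟩ := solvesPhi_Phi q u ψ
  have e1 : (fun x => (ω - q * (ω • Phi q u).fn x) * u.fn x ^ 2 * ψ.fn x) =ᵐ[volume]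
      fun x => ω * (u.fn x ^ 2 * ψ.fn x - q * (u.fn x ^ 2 * (Phi q u).fn x * ψ.fn x)) := by
    filter_upwards [D12.fn_smul ω (Phi q u)] with x hx
    rw [hx, Pi.smul_apply, smul_eq_mul]
    ring
  have e2 : (∫ x, ⟪(ω • Phi q u).grad x, ψ.grad x⟫_ℝ)
      = ω * ∫ x, ⟪(Phi q u).grad x, ψ.grad x⟫_ℝ := by
    rw [← integral_const_mul]
    refine integral_congr_ae ?_
    filter_upwards [D12.grad_smul ω (Phi q u)] with x hx
    rw [hx, Pi.smul_apply, real_inner_smul_left]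
  refine ⟨((i2.sub (i1.const_mul q)).const_mul ω).congr e1.symm, ?_⟩
  rw [integral_congr_ae e1, e2, integral_const_mul, integral_sub i2 (i1.const_mul q),
    integral_const_mul]
  linear_combination ω * h

/-- Both arguments carry a factor `1 - qΦ`: this is the origin of the square in the matter equation.
-/
theorem inner_toL2_sub_smul_mulL (q : ℝ) (u v : H1) (Φ : D12) :
    ⟪H1.toL2 u - q • mulL u Φ, H1.toL2 v - q • mulL v Φ⟫_ℝ
      = ∫ x, (1 - q * Φ.fn x) ^ 2 * u.fn x * v.fn x := by
  rw [L2.inner_def]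
  refine integral_congr_ae ?_
  filter_upwards [coeFn_toL2_sub_smul_mulL q u Φ, coeFn_toL2_sub_smul_mulL q v Φ] with x hu hv
  rw [hu, hv, RCLike.inner_apply, conj_trivial]
  ring

theorem integrable_sq_mul_mul (q : ℝ) (u v : H1) (Φ : D12) :
    Integrable fun x => (1 - q * Φ.fn x) ^ 2 * u.fn x * v.fn x := by
  refine ((Lp.memLp (H1.toL2 u - q • mulL u Φ)).integrable_mul
    (Lp.memLp (H1.toL2 v - q • mulL v Φ))).congr ?_
  filter_upwards [coeFn_toL2_sub_smul_mulL q u Φ, coeFn_toL2_sub_smul_mulL q v Φ] with x hu hv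
  rw [Pi.mul_apply, hu, hv]
  ring

theorem coeFn_sub_mul_smul_sq_mul (q ω : ℝ) (u v : H1) (Φ : D12) :
    (fun x => (ω - q * (ω • Φ).fn x) ^ 2 * u.fn x * v.fn x) =ᵐ[volume]
      fun x => ω ^ 2 * ((1 - q * Φ.fn x) ^ 2 * u.fn x * v.fn x) := by
  filter_upwards [D12.fn_smul ω Φ] with x h
  rw [h, Pi.smul_apply, smul_eq_mul]
  ring

theorem solvesMatter_smul_Phi {W : ℝ → ℝ} {C : ℝ} (hW : ContDiff ℝ 1 W) (hW0 : W 0 = 0)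
    (hC : ∀ s, |deriv W s| ≤ C * (|s| + |s| ^ 5)) (q : ℝ) (u : H1) (ω : ℝ)
    (h : fderiv ℝ (J W) u = ω ^ 2 • fderiv ℝ (K q) u) :
    SolvesMatter W q u (ω • Phi q u) ω := by
  intro v
  obtain ⟨L, hL, hJ⟩ := exists_hasFDerivAt_J hW hC hW0 u
  have h1 : L v = ω ^ 2 * fderiv ℝ (K q) u v := by
    rw [← hJ.fderiv]
    exact DFunLike.congr_fun h v
  rw [fderiv_K_apply, inner_toL2_sub_smul_mulL, hL, ← integral_const_mul] at h1
  have e := coeFn_sub_mul_smul_sq_mul q ω u v (Phi q u)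
  exact ⟨integrable_deriv_mul hW hC u v,
    ((integrable_sq_mul_mul q u v (Phi q u)).const_mul _).congr e.symm,
    h1.trans (integral_congr_ae e).symm⟩

theorem proposition12
    (W : ℝ → ℝ) (hW : ContDiff ℝ 1 W) (hW0 : W 0 = 0)
    (hgrowth : ∃ C : ℝ, ∀ s : ℝ, |deriv W s| ≤ C * (|s| + |s| ^ 5))
    (q : ℝ) (hq : 0 < q) :
    (∀ u : H1, ∃! Φ : D12, SolvesPhi q u Φ) ∧
    Differentiable ℝ (J W) ∧ Differentiable ℝ (K q) ∧
    ∀ (u : H1) (ω : ℝ),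
      fderiv ℝ (J W) u = ω ^ 2 • fderiv ℝ (K q) u →
        SolvesMatter W q u (ω • Phi q u) ω ∧ SolvesGauss q u (ω • Phi q u) ω := by
  obtain ⟨C, hC⟩ := hgrowth
  refine ⟨existsUnique_solvesPhi q, fun u => ?_, fun u => (hasFDerivAt_K q u).differentiableAt,
    fun u ω h => ⟨solvesMatter_smul_Phi hW hW0 hC q u ω h, solvesGauss_smul_Phi q u ω⟩⟩
  obtain ⟨L, -, hL⟩ := exists_hasFDerivAt_J hW hC hW0 u
  exact hL.differentiableAt
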